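/- Let $D^2\subset\mathbb{R}^2$ be the closed unit disc with polar coordinates $(r,\theta)$ and area form $\omega=2r\,\mathrm{d}r\wedge\mathrm{d}\theta$. Let $H_s\colon D^2\to\mathbb{R}$, $s\in\mathbb{R}/2\pi\mathbb{Z}$, be a smooth $2\pi$-periodic Hamiltonian function (smooth in $(s,z)$ up to the boundary), let $X_s$ be its Hamiltonian vector field, defined by $\omega(X_s,\cdot)=\mathrm{d}H_s$, and let $\psi=\Psi_{2\pi}$ be the time-$2\pi$ map of the Hamiltonian isotopy $\Psi_s$ of $D^2$ given by $\Psi_0=\mathrm{id}$, $\frac{\mathrm{d}}{\mathrm{d}s}\Psi_s=X_s\circ\Psi_s$. Assume that on a collar neighbourhood of $\partial D^2$ in $D^2$ the function $H_s$ is autonomous (independent of $s$) and depends only on $r$. Then $\psi$ embeds into a Reeb flow on $S^3$ with a disc-like global surface of section. That is, there are a smooth contact form $\alpha$ on $S^3$, with Reeb vector field $R$ (so $\alpha(R)=1$ and $\mathrm{d}\alpha(R,\cdot)=0$), and a smooth embedding $e\colon D^2\to S^3$ with image $\Sigma$ such that (i) $\partial\Sigma=e(\partial D^2)$ is a periodic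 orbit of $R$; (ii) $\mathrm{Int}(\Sigma)=e(\mathrm{Int}\,D^2)$ is transverse to $R$, and the orbit of $R$ through any point of $S^3\setminus\partial\Sigma$ meets $\mathrm{Int}(\Sigma)$ both in forward and in backward time; (iii) there is a radial reparametrisation $\rho\colon D^2\to D^2$, $\rho(r\mathrm{e}^{\mathrm{i}\theta})=g(r)\mathrm{e}^{\mathrm{i}\theta}$, with $g\colon[0,1]\to[0,1]$ an increasing homeomorphism, which restricts to a smooth diffeomorphism of $\mathrm{Int}(D^2)$ (but need not be smooth along $\partial D^2$), such that, for the topological embedding $j=e\circ\rho$ of $D^2$ onto $\Sigma$, the map $\psi$ sends $\mathrm{Int}(D^2)$ to itself and, for every $z\in\mathrm{Int}(D^2)$, the first intersection point in forward (positive) time of the Reeb orbit through $j(z)$ with $\mathrm{Int}(\Sigma)$ is $j(\psi(z))$. -/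

import Mathlib

open scoped ContDiff

/-! ### Hamiltonian isotopies of the closed unit disc -/

/-- The closed unit disc `D²`, as a subset of `ℂ = ℝ²`. -/
def closedDisc : Set ℂ := Metric.closedBall 0 1

/-- The interior of `D²`. -/
def openDisc : Set ℂ := Metric.ball 0 1

/-- The area form `ω = 2 r dr ∧ dθ = 2 dx ∧ dy` on the disc, evaluated on `(X, Y)`. -/
def discAreaForm (X Y : ℂ) : ℝ := 2 * (X.re * Y.im - X.im * Y.re)

/-- `X_s` is the Hamiltonian vector field of `H_s` on `D²`: `ω(X_s, ·) = dH_s`, where `dH_s` is the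
differential in the space variable for fixed `s` (one-sided at boundary points of the disc). -/
def IsHamiltonianVectorField (H : ℝ → ℂ → ℝ) (X : ℝ → ℂ → ℂ) : Prop :=
  ∀ s : ℝ, ∀ z ∈ closedDisc, ∀ Y : ℂ,
    discAreaForm (X s z) Y = fderivWithin ℝ (H s) closedDisc z Y

/-- `Ψ` is the isotopy of `D²` starting at the identity and generated by the time-dependent vector
field `X`: `Ψ_0 = id` and `d/ds Ψ_s = X_s ∘ Ψ_s`. -/
structure IsIsotopyGeneratedBy (X : ℝ → ℂ → ℂ) (Ψ : ℝ → ℂ → ℂ) : Prop where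
  initial : ∀ z ∈ closedDisc, Ψ 0 z = z
  mapsTo : ∀ s : ℝ, ∀ z ∈ closedDisc, Ψ s z ∈ closedDisc
  deriv : ∀ s : ℝ, ∀ z ∈ closedDisc, HasDerivAt (fun σ => Ψ σ z) (X s (Ψ s z)) s

/-- On a collar neighbourhood of `∂D²` the function `H_s` depends neither on `s` nor on the angle,
only on the radius. -/
def IsAutonomousRadialOnCollar (H : ℝ → ℂ → ℝ) : Prop :=
  ∃ r₀ : ℝ, r₀ < 1 ∧ ∃ f : ℝ → ℝ, ∀ s : ℝ, ∀ z ∈ closedDisc, r₀ < ‖z‖ → H s z = f ‖z‖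

/-! ### Contact forms and Reeb flows on the 3-sphere

Differential forms on `S³ ⊆ ℂ²` are given as restrictions of forms that are defined on `ℂ²` and are
smooth at the points of `S³`; every smooth form on `S³` arises in this way. Only the values of
`α` and `dα` on vectors tangent to `S³` enter, that is, the pull-backs to `S³`. -/

/-- `ℂ²` with its Euclidean norm, regarded as a real vector space. -/
abbrev CTwo : Type := EuclideanSpace ℂ (Fin 2)

/-- The unit sphere `S³` in `ℂ²`. -/
def sphereThree : Set CTwo := Metric.sphere 0 1

/-- `v` lies in the tangent space `T_p S³`, the real orthogonal complement of `p`. -/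
def IsTangentToSphere (p v : CTwo) : Prop := (inner ℂ p v).re = 0

/-- The exterior derivative of a 1-form `α`, at the point `p` on the vectors `(u, v)`. -/
noncomputable def dOneForm (α : CTwo → CTwo →L[ℝ] ℝ) (p u v : CTwo) : ℝ :=
  extDeriv (fun q => ContinuousAlternatingMap.ofSubsingleton ℝ CTwo ℝ (0 : Fin 1) (α q)) p ![u, v]

/-- The usual coordinate formula for the exterior derivative. -/
theorem dOneForm_eq (α : CTwo → CTwo →L[ℝ] ℝ) (p u v : CTwo) (h : DifferentiableAt ℝ α p) :
    dOneForm α p u v = fderiv ℝ α p u v - fderiv ℝ α p v u := by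
  have hd : DifferentiableAt ℝ
      (fun q => ContinuousAlternatingMap.ofSubsingleton ℝ CTwo ℝ (0 : Fin 1) (α q)) p :=
    (ContinuousAlternatingMap.ofSubsingletonLIE (𝕜 := ℝ) (E := CTwo) (F := ℝ)
      (0 : Fin 1)).toContinuousLinearEquiv.differentiableAt.comp p h
  have key : ∀ x w : CTwo, fderiv ℝ (fun q => α q w) p x = fderiv ℝ α p x w := by
    intro x w
    rw [fderiv_clm_apply h (differentiableAt_const w)]
    simp
  unfold dOneForm
  rw [extDeriv_apply hd]
  simp [Fin.sum_univ_two, Fin.removeNth, key, sub_eq_add_neg]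

/-- `α` is a smooth contact form on `S³`: the 3-form `α ∧ dα` vanishes nowhere on `S³`. -/
structure IsContactFormOnSphere (α : CTwo → CTwo →L[ℝ] ℝ) : Prop where
  smooth : ∀ p ∈ sphereThree, ContDiffAt ℝ ∞ α p
  contact : ∀ p ∈ sphereThree, ∀ u v w : CTwo,
    IsTangentToSphere p u → IsTangentToSphere p v → IsTangentToSphere p w →
    LinearIndependent ℝ ![u, v, w] →
    α p u * dOneForm α p v w - α p v * dOneForm α p u w + α p w * dOneForm α p u v ≠ 0

/-- `R` is the Reeb vector field of `α` on `S³`: it is tangent to `S³`, `α(R) = 1`, and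
`dα(R, ·) = 0` on `T S³`. -/
structure IsReebVectorField (α : CTwo → CTwo →L[ℝ] ℝ) (R : CTwo → CTwo) : Prop where
  tangent : ∀ p ∈ sphereThree, IsTangentToSphere p (R p)
  normalized : ∀ p ∈ sphereThree, α p (R p) = 1
  kernel : ∀ p ∈ sphereThree, ∀ v : CTwo, IsTangentToSphere p v → dOneForm α p (R p) v = 0

/-- `φ` is the (complete) flow on `S³` of the vector field `R`. -/
structure IsFlowOnSphere (R : CTwo → CTwo) (φ : ℝ → CTwo → CTwo) : Prop where
  initial : ∀ p ∈ sphereThree, φ 0 p = p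
  mapsTo : ∀ t : ℝ, ∀ p ∈ sphereThree, φ t p ∈ sphereThree
  deriv : ∀ t : ℝ, ∀ p ∈ sphereThree, HasDerivAt (fun τ => φ τ p) (R (φ t p)) t

/-! ### Disc-like global surfaces of section and return maps -/

/-- `e` restricts to a smooth embedding of the closed disc `D²`, up to and including its boundary,
into `S³` (an injective immersion; the disc is compact). -/
structure IsSmoothDiscEmbedding (e : ℂ → CTwo) : Prop where
  smooth : ContDiffOn ℝ ∞ e closedDisc
  mapsTo : Set.MapsTo e closedDisc sphereThree
  injective : Set.InjOn e closedDisc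
  immersion : ∀ z ∈ closedDisc, Function.Injective (fderivWithin ℝ e closedDisc z)

/-- The disc `Σ = e(D²)` is a global surface of section for the vector field `R` on `S³` with
flow `φ`. Its boundary is `e(∂D²)`, its interior is `e(Int D²)`. -/
structure IsDiscGlobalSurfaceOfSection (R : CTwo → CTwo) (φ : ℝ → CTwo → CTwo)
    (e : ℂ → CTwo) : Prop where
  embedding : IsSmoothDiscEmbedding e
  /-- the boundary of the disc is a periodic orbit -/
  boundary : ∃ p ∈ sphereThree, ∃ T : ℝ, 0 < T ∧ φ T p = p ∧
    e '' Metric.sphere 0 1 = Set.range (fun t => φ t p)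
  /-- the interior of the disc is transverse to the vector field -/
  transverse : ∀ z ∈ openDisc, R (e z) ∉ Set.range (fderivWithin ℝ e closedDisc z)
  forward : ∀ p ∈ sphereThree \ e '' Metric.sphere 0 1, ∃ t : ℝ, 0 < t ∧ φ t p ∈ e '' openDisc
  backward : ∀ p ∈ sphereThree \ e '' Metric.sphere 0 1, ∃ t : ℝ, t < 0 ∧ φ t p ∈ e '' openDisc

/-- `q` is the image of `p` under the Poincaré return map to `S` of the flow `φ`: the point where
the flow line of `p` hits `S` for the first time in forward time. -/
def IsFirstReturn (φ : ℝ → CTwo → CTwo) (S : Set CTwo) (p q : CTwo) : Prop :=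
  ∃ τ : ℝ, IsLeast {t : ℝ | 0 < t ∧ φ t p ∈ S} τ ∧ φ τ p = q

/-- `ρ` is a radial reparametrisation `r e^{iθ} ↦ g(r) e^{iθ}` of the closed disc: a homeomorphism
of `D²` that restricts to a smooth diffeomorphism of the interior, but need not be smooth along
the boundary. -/
structure IsRadialReparametrization (ρ : ℂ → ℂ) : Prop where
  radial : ∃ g : ℝ → ℝ, ContinuousOn g (Set.Icc 0 1) ∧ StrictMonoOn g (Set.Icc 0 1) ∧
    g 0 = 0 ∧ g 1 = 1 ∧
    ∀ r ∈ Set.Icc (0 : ℝ) 1, ∀ u : ℂ, ‖u‖ = 1 → ρ (r • u) = g r • u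
  smooth : ContDiffOn ℝ ∞ ρ openDisc
  immersion : ∀ z ∈ openDisc, Function.Injective (fderiv ℝ ρ z)

/-- The map `ψ` of the closed disc embeds into a Reeb flow on `S³`: there are a contact form on `S³`
and a disc-like global surface of section `Σ = e(D²)` for its Reeb flow such that `ψ`, on `Int D²`,
is the Poincaré return map on `Int Σ`. Here `D²` is identified with `Σ` by the topological embedding
`e ∘ ρ : D² → S³`, which is smooth on the interior and which differs from the smooth embedding `e`
by a radial reparametrisation `ρ` of the disc. -/
def EmbedsIntoReebFlowOnSphere (ψ : ℂ → ℂ) : Prop :=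
  ∃ (α : CTwo → CTwo →L[ℝ] ℝ) (R : CTwo → CTwo) (φ : ℝ → CTwo → CTwo) (e : ℂ → CTwo) (ρ : ℂ → ℂ),
    IsContactFormOnSphere α ∧ IsReebVectorField α R ∧ IsFlowOnSphere R φ ∧
    IsDiscGlobalSurfaceOfSection R φ e ∧ IsRadialReparametrization ρ ∧
    ∀ z ∈ openDisc, ψ z ∈ openDisc ∧ IsFirstReturn φ (e '' openDisc) (e (ρ z)) (e (ρ (ψ z)))

/-! The contact form is written down explicitly, in an open book of `S³` with disc pages `arg z₂ =
const` and binding `z₂ = 0`. By the collar condition `H_s(w) = F(‖w‖²) + K_s(w)` with `K` vanishing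
near the boundary of the disc. Off the binding put `s = arg z₂` and `w = z₁ e^{-iks}` with an
integer `k`, and consider `α = |z₁|² dθ₁ + b |z₂|² dθ₂` with `b = k + (F(1 - |z₂|²) - F(1)) / |z₂|²
+ K_s(w) / |z₂|²`. Since `|z₁|² + |z₂|² = 1`, in the coordinates `(s, w)`, with `w = r e^{iθ}`, this
reads `α = r² dθ + (H_s(w) + k - F(1)) ds`. Hence `dα = ω + dH_s ∧ ds`, with `dH_s` the spatial
differential, is annihilated by `∂_s + X_s`: Reeb orbits are reparametrised orbits of the suspension
of the isotopy, and the return map of the page `s = 0` is the time-`2π` map.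

Two points make this global. The function `b` is smooth across the binding, because `K` vanishes
there and the radial quotient is smooth by Hadamard's trick (`norm_sq_mul_radialQuotient`). The form
is contact for large `k`, because `α ∧ dα` is measured by `contactDensity`, which is `2k` plus terms
bounded independently of `k` (`exists_contactDensity_ge`); since `k` is an integer, the twist by
`e^{iks}` is trivial at `s = 2π`.

The dynamics rests on `kernelField_bCoeff`, which identifies the kernel of `dα` with the suspension
direction, and on `isFirstReturn_of_suspension`, which passes from the suspension to the Reeb flow
by a time change. The page appears as the graph `(z, √(1 - |z|²))`, which is not smooth at the
boundary; stereographic coordinates repair this at the price of a radial reparametrisation. -/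

/-! ### Real-linear coordinates on `ℂ²` -/

/-- The `j`-th complex coordinate on `ℂ²` as a real-linear map. -/
noncomputable def coordCLM (j : Fin 2) : CTwo →L[ℝ] ℂ :=
  (EuclideanSpace.proj j : CTwo →L[ℂ] ℂ).restrictScalars ℝ

@[simp] lemma coordCLM_apply (j : Fin 2) (p : CTwo) : coordCLM j p = p j := rfl

/-- The inclusion of the `j`-th complex coordinate axis as a real-linear map. -/
noncomputable def inclCLM (j : Fin 2) : ℂ →L[ℝ] CTwo :=
  LinearMap.toContinuousLinearMap
    { toFun := fun a => EuclideanSpace.single j a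
      map_add' := fun a b => by ext i; by_cases h : i = j <;> simp [h]
      map_smul' := fun c a => by ext i; by_cases h : i = j <;> simp [h] }

@[simp] lemma inclCLM_zero_zero (a : ℂ) : inclCLM 0 a 0 = a := by simp [inclCLM]
@[simp] lemma inclCLM_zero_one (a : ℂ) : inclCLM 0 a 1 = 0 := by simp [inclCLM]
@[simp] lemma inclCLM_one_zero (a : ℂ) : inclCLM 1 a 0 = 0 := by simp [inclCLM]
@[simp] lemma inclCLM_one_one (a : ℂ) : inclCLM 1 a 1 = a := by simp [inclCLM]

/-- The point of `ℂ²` with given coordinates. -/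
noncomputable def pairC (a b : ℂ) : CTwo := inclCLM 0 a + inclCLM 1 b

@[simp] lemma pairC_zero (a b : ℂ) : pairC a b 0 = a := by simp [pairC]
@[simp] lemma pairC_one (a b : ℂ) : pairC a b 1 = b := by simp [pairC]

lemma CTwo.ext {p q : CTwo} (h0 : p 0 = q 0) (h1 : p 1 = q 1) : p = q := by
  ext i; fin_cases i <;> simpa

lemma pairC_coord (p : CTwo) : pairC (p 0) (p 1) = p := CTwo.ext (by simp) (by simp)

lemma incl_add_incl (p : CTwo) : inclCLM 0 (p 0) + inclCLM 1 (p 1) = p := pairC_coord p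

lemma HasDerivAt.pairC {f g : ℝ → ℂ} {f' g' : ℂ} {t : ℝ} (hf : HasDerivAt f f' t)
    (hg : HasDerivAt g g' t) : HasDerivAt (fun t => pairC (f t) (g t)) (pairC f' g') t :=
  ((inclCLM 0).hasFDerivAt.comp_hasDerivAt t hf).add ((inclCLM 1).hasFDerivAt.comp_hasDerivAt t hg)

lemma norm_sq_CTwo (p : CTwo) : ‖p‖ ^ 2 = ‖p 0‖ ^ 2 + ‖p 1‖ ^ 2 := by
  simp [EuclideanSpace.norm_sq_eq]

lemma mem_sphereThree {p : CTwo} : p ∈ sphereThree ↔ ‖p 0‖ ^ 2 + ‖p 1‖ ^ 2 = 1 := by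
  rw [← norm_sq_CTwo, sphereThree, mem_sphere_zero_iff_norm]
  exact (pow_eq_one_iff_of_nonneg (norm_nonneg p) two_ne_zero).symm

lemma isTangentToSphere_iff {p v : CTwo} : IsTangentToSphere p v ↔
    (p 0).re * (v 0).re + (p 0).im * (v 0).im + ((p 1).re * (v 1).re + (p 1).im * (v 1).im) = 0 := by
  unfold IsTangentToSphere
  rw [PiLp.inner_apply]
  simp [Fin.sum_univ_two]
  ring_nf

lemma clm_apply_eq (L : CTwo →L[ℝ] ℝ) (v : CTwo) : L v =
    (v 0).re * L (inclCLM 0 1) + (v 0).im * L (inclCLM 0 Complex.I) +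
    ((v 1).re * L (inclCLM 1 1) + (v 1).im * L (inclCLM 1 Complex.I)) := by
  have h : ∀ (j : Fin 2) (a : ℂ), L (inclCLM j a) =
      a.re * L (inclCLM j 1) + a.im * L (inclCLM j Complex.I) := by
    intro j a
    have : a = a.re • (1 : ℂ) + a.im • Complex.I := by
      simp [Complex.re_add_im]
    conv_lhs => rw [this]
    simp only [map_add, map_smul, smul_eq_mul]
  conv_lhs => rw [← incl_add_incl v]
  rw [map_add, h 0 (v 0), h 1 (v 1)]

/-! ### The forms `|z₁|² dθ₁ + b |z₂|² dθ₂`, their kernel and the contact condition -/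

/-- The bilinear form `(a, b) ↦ Im (conj a * b)` on `ℂ`. -/
noncomputable def imForm : ℂ →L[ℝ] ℂ →L[ℝ] ℝ :=
  ((ContinuousLinearMap.compL ℝ ℂ ℂ ℝ Complex.imCLM).comp (ContinuousLinearMap.mul ℝ ℂ)).comp
    Complex.conjCLE.toContinuousLinearMap

lemma imForm_apply (a b : ℂ) : imForm a b = a.re * b.im - a.im * b.re := by
  simp [imForm]; ring

/-- The bilinear form `(u, v) ↦ Im (conj (u j) * v j)` on `ℂ²`. -/
noncomputable def coordForm (j : Fin 2) : CTwo →L[ℝ] CTwo →L[ℝ] ℝ :=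
  imForm.bilinearComp (coordCLM j) (coordCLM j)

lemma coordForm_apply (j : Fin 2) (u v : CTwo) :
    coordForm j u v = (u j).re * (v j).im - (u j).im * (v j).re := by
  simp [coordForm, imForm_apply]

/-- The 1-form `|z₁|² dθ₁ + b |z₂|² dθ₂`. -/
noncomputable def bForm (b : CTwo → ℝ) (p : CTwo) : CTwo →L[ℝ] ℝ :=
  coordForm 0 p + b p • coordForm 1 p

lemma bForm_contDiffAt {b : CTwo → ℝ} {p : CTwo} (hb : ContDiffAt ℝ ∞ b p) :
    ContDiffAt ℝ ∞ (bForm b) p :=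
  (coordForm 0).contDiff.contDiffAt.add (hb.smul (coordForm 1).contDiff.contDiffAt)

lemma dOneForm_bForm {b : CTwo → ℝ} {p : CTwo} (hb : ContDiffAt ℝ ∞ b p) (u v : CTwo) :
    dOneForm (bForm b) p u v =
      2 * coordForm 0 u v + 2 * b p * coordForm 1 u v
        + fderiv ℝ b p u * coordForm 1 p v - fderiv ℝ b p v * coordForm 1 p u := by
  have hbd : DifferentiableAt ℝ b p := hb.differentiableAt (by simp)
  have h : HasFDerivAt (bForm b) (coordForm 0 + (b p • coordForm 1 +
      (fderiv ℝ b p).smulRight (coordForm 1 p))) p :=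
    (coordForm 0).hasFDerivAt.add (hbd.hasFDerivAt.smul (coordForm 1).hasFDerivAt)
  rw [dOneForm_eq _ _ _ _ h.differentiableAt, h.fderiv]
  simp [coordForm_apply]
  ring

/-- A vector field spanning the kernel of the restriction of `d (bForm b)` to spheres. -/
noncomputable def kernelField (b : CTwo → ℝ) (p : CTwo) : CTwo :=
  pairC (Complex.I * ((2 * b p + fderiv ℝ b p (inclCLM 1 (p 1)) : ℝ) * p 0 - (‖p 1‖ ^ 2 : ℝ) *
      (fderiv ℝ b p (inclCLM 0 1) + fderiv ℝ b p (inclCLM 0 Complex.I) * Complex.I)))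
    ((2 * Complex.I - fderiv ℝ b p (inclCLM 0 (Complex.I * p 0))) * p 1)

/-- The value of `bForm b` on `kernelField b`, on the unit sphere. -/
noncomputable def contactDensity (b : CTwo → ℝ) (p : CTwo) : ℝ :=
  2 * b p + ‖p 0‖ ^ 2 * fderiv ℝ b p (inclCLM 1 (p 1)) - ‖p 1‖ ^ 2 * fderiv ℝ b p (inclCLM 0 (p 0))

/-- Valid at every point of `ℂ²`, not only on the unit sphere. Flows of multiples of this field
therefore conserve the norm, which is how they are shown to stay on `S³`. -/
lemma isTangentToSphere_kernelField (b : CTwo → ℝ) (p : CTwo) :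
    IsTangentToSphere p (kernelField b p) := by
  rw [isTangentToSphere_iff]
  rw [kernelField, clm_apply_eq _ (inclCLM 0 (Complex.I * p 0))]
  simp [Complex.sq_norm, Complex.normSq_apply]
  ring

lemma bForm_kernelField (b : CTwo → ℝ) {p : CTwo} (hp : p ∈ sphereThree) :
    bForm b p (kernelField b p) = contactDensity b p := by
  rw [mem_sphereThree] at hp
  rw [contactDensity, kernelField, clm_apply_eq _ (inclCLM 0 (Complex.I * p 0)),
    clm_apply_eq _ (inclCLM 0 (p 0))]
  simp [bForm, coordForm_apply, Complex.sq_norm, Complex.normSq_apply] at hp ⊢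
  linear_combination (2 * b p) * hp

/-- The contraction of `d (bForm b)` with `kernelField b` is a multiple of `v ↦ ⟨p, v⟩`, so it
vanishes exactly where needed, on tangent vectors. -/
lemma dOneForm_bForm_kernelField {b : CTwo → ℝ} {p v : CTwo} (hb : ContDiffAt ℝ ∞ b p)
    (hv : IsTangentToSphere p v) : dOneForm (bForm b) p (kernelField b p) v = 0 := by
  rw [isTangentToSphere_iff] at hv
  rw [dOneForm_bForm hb, clm_apply_eq (fderiv ℝ b p) (kernelField b p), clm_apply_eq (fderiv ℝ b p) v,
    kernelField, clm_apply_eq _ (inclCLM 0 (Complex.I * p 0)), clm_apply_eq _ (inclCLM 1 (p 1))]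
  simp [coordForm_apply, Complex.sq_norm, Complex.normSq_apply]
  linear_combination (-4 * b p - 2 * fderiv ℝ b p (inclCLM 1 1) * (p 1).re
    - 2 * fderiv ℝ b p (inclCLM 1 Complex.I) * (p 1).im) * hv

lemma finrank_tangent {p : CTwo} (hp : p ∈ sphereThree) (ℓ : CTwo →ₗ[ℝ] ℝ)
    (hℓ : ∀ v, ℓ v = (inner ℂ p v).re) : Module.finrank ℝ (LinearMap.ker ℓ) = 3 := by
  have h0 : ℓ ≠ 0 := by
    intro h
    have h1 := hℓ p
    rw [h, inner_self_eq_norm_sq_to_K] at h1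
    rw [sphereThree, mem_sphere_zero_iff_norm] at hp
    simp [hp] at h1
  have h1 := Module.Dual.finrank_ker_add_one_of_ne_zero (f := ℓ) h0
  have h2 : Module.finrank ℝ CTwo = 4 := by
    rw [← Module.finrank_mul_finrank ℝ ℂ CTwo]
    simp
  omega

lemma tangent_mem_span {p u v w x : CTwo} (hp : p ∈ sphereThree) (hu : IsTangentToSphere p u)
    (hv : IsTangentToSphere p v) (hw : IsTangentToSphere p w)
    (h : LinearIndependent ℝ ![u, v, w]) (hx : IsTangentToSphere p x) :
    ∃ a b c : ℝ, x = a • u + b • v + c • w := by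
  let ℓ : CTwo →ₗ[ℝ] ℝ :=
    { toFun := fun v => (inner ℂ p v).re
      map_add' := by intros; simp
      map_smul' := by
        intro c v
        rw [← Complex.coe_smul, inner_smul_right]
        simp }
  have hker := finrank_tangent hp ℓ (fun _ => rfl)
  have hle : Submodule.span ℝ (Set.range ![u, v, w]) ≤ LinearMap.ker ℓ := by
    rw [Submodule.span_le]
    rintro _ ⟨i, rfl⟩
    fin_cases i
    · exact hu
    · exact hv
    · exact hw
  have heq := Submodule.eq_of_le_of_finrank_eq hle
    (by rw [hker, finrank_span_eq_card h, Fintype.card_fin])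
  have hxm : x ∈ Submodule.span ℝ (Set.range ![u, v, w]) := by rw [heq]; exact hx
  obtain ⟨c, hc⟩ := (Submodule.mem_span_range_iff_exists_fun ℝ).1 hxm
  refine ⟨c 0, c 1, c 2, ?_⟩
  rw [← hc]
  simp [Fin.sum_univ_three]

/-- A 1-form and a 2-form wedge to a 3-form: nonvanishing on one triple of tangent vectors
implies nonvanishing on every basis of the tangent space. -/
lemma wedge_ne_zero {p u v w x y z : CTwo} (hp : p ∈ sphereThree)
    (hu : IsTangentToSphere p u) (hv : IsTangentToSphere p v) (hw : IsTangentToSphere p w)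
    (h : LinearIndependent ℝ ![u, v, w]) (hx : IsTangentToSphere p x) (hy : IsTangentToSphere p y)
    (hz : IsTangentToSphere p z) (a : CTwo →L[ℝ] ℝ) (δ : CTwo → CTwo → ℝ)
    (hadd : ∀ x y z, δ (x + y) z = δ x z + δ y z) (hsmul : ∀ (c : ℝ) x y, δ (c • x) y = c * δ x y)
    (hskew : ∀ x y, δ x y = -δ y x)
    (hne : a x * δ y z - a y * δ x z + a z * δ x y ≠ 0) :
    a u * δ v w - a v * δ u w + a w * δ u v ≠ 0 := by
  have hself : ∀ x, δ x x = 0 := fun x => by linarith [hskew x x]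
  have hadd' : ∀ x y z, δ z (x + y) = δ z x + δ z y := fun x y z => by
    rw [hskew, hadd, hskew x, hskew y]; ring
  have hsmul' : ∀ (c : ℝ) x y, δ y (c • x) = c * δ y x := fun c x y => by
    rw [hskew, hsmul, hskew x]; ring
  obtain ⟨x1, x2, x3, rfl⟩ := tangent_mem_span hp hu hv hw h hx
  obtain ⟨y1, y2, y3, rfl⟩ := tangent_mem_span hp hu hv hw h hy
  obtain ⟨z1, z2, z3, rfl⟩ := tangent_mem_span hp hu hv hw h hz
  intro h0
  apply hne
  simp only [hadd, hadd', hsmul, hsmul', hself, map_add, map_smul, smul_eq_mul,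
    hskew v u, hskew w u, hskew w v]
  -- The coefficient is the determinant of the change of triples.
  linear_combination (x1 * y2 * z3 - x1 * y3 * z2 - x2 * y1 * z3 + x2 * y3 * z1 + x3 * y1 * z2
    - x3 * y2 * z1) * h0

/-- It suffices to test `α ∧ dα` on one tangent frame. On the frame `ip, (-z̄₂, z̄₁), i(-z̄₂, z̄₁)`
its value is `contactDensity b p`. -/
lemma bForm_contact {b : CTwo → ℝ} {p : CTwo} (hp : p ∈ sphereThree) (hb : ContDiffAt ℝ ∞ b p)
    (hD : contactDensity b p ≠ 0) {u v w : CTwo} (hu : IsTangentToSphere p u)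
    (hv : IsTangentToSphere p v) (hw : IsTangentToSphere p w)
    (h : LinearIndependent ℝ ![u, v, w]) :
    bForm b p u * dOneForm (bForm b) p v w - bForm b p v * dOneForm (bForm b) p u w
      + bForm b p w * dOneForm (bForm b) p u v ≠ 0 := by
  refine wedge_ne_zero (x := pairC (Complex.I * p 0) (Complex.I * p 1))
    (y := pairC (-starRingEnd ℂ (p 1)) (starRingEnd ℂ (p 0)))
    (z := pairC (-Complex.I * starRingEnd ℂ (p 1)) (Complex.I * starRingEnd ℂ (p 0)))
    hp hu hv hw h ?_ ?_ ?_ _ _ ?_ ?_ ?_ ?_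
  · rw [isTangentToSphere_iff]; simp; ring
  · rw [isTangentToSphere_iff]; simp; ring
  · rw [isTangentToSphere_iff]; simp; ring
  · intro x y z
    simp only [dOneForm_bForm hb, map_add, add_apply]; ring
  · intro c x y
    simp only [dOneForm_bForm hb, map_smul, smul_apply, smul_eq_mul]; ring
  · intro x y
    simp only [dOneForm_bForm hb, coordForm_apply]; ring
  · convert hD using 1
    rw [mem_sphereThree] at hp
    simp only [dOneForm_bForm hb]
    rw [contactDensity, clm_apply_eq (fderiv ℝ b p) (inclCLM 0 (p 0)),
      clm_apply_eq (fderiv ℝ b p) (inclCLM 1 (p 1)),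
      clm_apply_eq (fderiv ℝ b p) (pairC (Complex.I * p 0) (Complex.I * p 1)),
      clm_apply_eq (fderiv ℝ b p) (pairC (-starRingEnd ℂ (p 1)) (starRingEnd ℂ (p 0))),
      clm_apply_eq (fderiv ℝ b p)
        (pairC (-Complex.I * starRingEnd ℂ (p 1)) (Complex.I * starRingEnd ℂ (p 0)))]
    simp [bForm, coordForm_apply, Complex.sq_norm, Complex.normSq_apply] at hp ⊢
    linear_combination (4 * b p + 2 * b p * ((p 0).re * (p 0).re + (p 0).im * (p 0).im +
      ((p 1).re * (p 1).re + (p 1).im * (p 1).im) - 1) +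
      ((p 0).re * (p 0).re + (p 0).im * (p 0).im) * ((p 1).re * fderiv ℝ b p (inclCLM 1 1) +
        (p 1).im * fderiv ℝ b p (inclCLM 1 Complex.I)) -
      ((p 1).re * (p 1).re + (p 1).im * (p 1).im) * ((p 0).re * fderiv ℝ b p (inclCLM 0 1) +
        (p 0).im * fderiv ℝ b p (inclCLM 0 Complex.I))) * hp

/-! ### Analytic tools: global flows, parameter integrals, cutoffs -/

/-- A bounded, globally Lipschitz vector field has a complete flow. -/
theorem exists_global_flow {E : Type*} [NormedAddCommGroup E] [NormedSpace ℝ E] [CompleteSpace E]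
    {v : E → E} {K : NNReal} (hK : LipschitzWith K v) {L : NNReal} (hL : ∀ x, ‖v x‖ ≤ L) :
    ∃ φ : ℝ → E → E, (∀ x, φ 0 x = x) ∧ ∀ t x, HasDerivAt (fun τ => φ τ x) (v (φ t x)) t := by
  have hloc : ∀ (x : E) (n : ℕ), ∃ c : ℝ → E, c 0 = x ∧
      ∀ t ∈ Set.Ioo (-(n + 1 : ℝ)) (n + 1), HasDerivAt c (v (c t)) t := by
    intro x n
    have hn : (0 : ℝ) < n + 1 := by positivity
    -- In time `n + 1` a curve of speed at most `L` stays within distance `L * (n + 1)` of `x`, so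
    -- Picard–Lindelöf covers the whole interval at once.
    have hpl : IsPicardLindelof (fun _ => v) (tmin := -(n + 1 : ℝ)) (tmax := n + 1)
        ⟨0, by constructor <;> linarith⟩ x (L * (n + 1)) 0 L K :=
      { lipschitzOnWith := fun _ _ => hK.lipschitzOnWith
        continuousOn := fun _ _ => continuousOn_const
        norm_le := fun _ _ y _ => hL y
        mul_max_le := by simp }
    obtain ⟨c, hc0, hc⟩ := hpl.exists_eq_forall_mem_Icc_hasDerivWithinAt₀
    exact ⟨c, hc0, fun t ht => (hc t (Set.Ioo_subset_Icc_self ht)).hasDerivAt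
      (Icc_mem_nhds ht.1 ht.2)⟩
  choose c hc0 hc using hloc
  have hagree : ∀ (x : E) (m n : ℕ), m ≤ n → ∀ t ∈ Set.Ioo (-(m + 1 : ℝ)) (m + 1),
      c x m t = c x n t := by
    intro x m n hmn t ht
    have hmn' : (m : ℝ) ≤ n := by exact_mod_cast hmn
    have hm : (0 : ℝ) ≤ m := by positivity
    refine ODE_solution_unique_of_mem_Ioo (v := fun _ => v) (s := fun _ => Set.univ) (t₀ := 0)
      (fun t _ => hK.lipschitzOnWith) (by constructor <;> linarith)
      (fun s hs => ⟨hc x m s hs, trivial⟩)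
      (fun s hs => ⟨hc x n s ⟨by linarith [hs.1], by linarith [hs.2]⟩, trivial⟩)
      (by rw [hc0, hc0]) ht
  have hmem : ∀ t : ℝ, t ∈ Set.Ioo (-((⌈|t|⌉₊ : ℕ) + 1 : ℝ)) ((⌈|t|⌉₊ : ℕ) + 1) := by
    intro t
    have h := abs_le.1 (Nat.le_ceil |t|)
    constructor <;> linarith [h.1, h.2]
  refine ⟨fun t x => c x ⌈|t|⌉₊ t, fun x => hc0 x _, fun t x => ?_⟩
  refine (hc x _ t (hmem t)).congr_of_eventuallyEq ?_
  filter_upwards [Ioo_mem_nhds (hmem t).1 (hmem t).2] with s hs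
  rcases le_total ⌈|s|⌉₊ ⌈|t|⌉₊ with h | h
  · exact hagree x _ _ h s (hmem s)
  · exact (hagree x _ _ h s hs).symm

universe u in
/-- Smoothness of integrals depending on a parameter. -/
theorem contDiff_intervalIntegral_nat {E : Type u} [NormedAddCommGroup E] [NormedSpace ℝ E]
    [ProperSpace E] (a b : ℝ) (n : ℕ) :
    ∀ {F : Type u} [NormedAddCommGroup F] [NormedSpace ℝ F] [CompleteSpace F]
      {g : E × ℝ → F}, ContDiff ℝ n g → ContDiff ℝ n (fun x => ∫ t in a..b, g (x, t)) := by
  -- The codomain varies in the induction, since the derivative takes values in `E →L[ℝ] F`; this is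
  -- also why `E` and `F` share a universe.
  induction n with
  | zero =>
    intro F _ _ _ g hg
    rw [Nat.cast_zero, contDiff_zero] at hg ⊢
    exact intervalIntegral.continuous_parametric_intervalIntegral_of_continuous'
      (f := fun x t => g (x, t)) hg _ _
  | succ n ih =>
    intro F _ _ _ g hg
    have hg1 : ContDiff ℝ 1 g := hg.of_le (by exact_mod_cast Nat.le_add_left 1 n)
    have hgd : Differentiable ℝ g := hg1.differentiable (by simp)
    have hg' : ContDiff ℝ n (fun q : E × ℝ => (fderiv ℝ g q).comp
        (ContinuousLinearMap.inl ℝ E ℝ)) :=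
      (hg.fderiv_right (m := n) (by push_cast; exact le_rfl)).clm_comp contDiff_const
    have hgc : Continuous g := hg.continuous
    push_cast
    refine contDiff_succ_iff_hasFDerivAt.2 ⟨_, ih hg', fun x => ?_⟩
    obtain ⟨C, hC⟩ := ((isCompact_closedBall x 1).prod
      (isCompact_uIcc (a := a) (b := b))).exists_bound_of_continuousOn hg'.continuous.continuousOn
    refine intervalIntegral.hasFDerivAt_integral_of_dominated_of_fderiv_le
      (μ := MeasureTheory.volume) (a := a) (b := b) (F := fun x t => g (x, t))
      (F' := fun x t => (fderiv ℝ g (x, t)).comp (ContinuousLinearMap.inl ℝ E ℝ)) (bound := fun _ => C)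
      (Metric.closedBall_mem_nhds x one_pos) ?_ ?_ ?_ ?_ ?_ ?_
    · exact Filter.Eventually.of_forall fun y =>
        (hgc.comp (by fun_prop : Continuous fun t : ℝ => (y, t))).aestronglyMeasurable
    · exact (hgc.comp (by fun_prop : Continuous fun t : ℝ => (x, t))).intervalIntegrable _ _
    · exact (hg'.continuous.comp
        (by fun_prop : Continuous fun t : ℝ => (x, t))).aestronglyMeasurable
    · exact Filter.Eventually.of_forall fun t ht y hy => hC (y, t) ⟨hy, Set.uIoc_subset_uIcc ht⟩
    · exact intervalIntegrable_const
    · refine Filter.Eventually.of_forall fun t _ y _ => ?_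
      exact (hgd (y, t)).hasFDerivAt.comp y (hasFDerivAt_prodMk_left y t)

theorem contDiff_intervalIntegral {E F : Type} [NormedAddCommGroup E] [NormedSpace ℝ E]
    [ProperSpace E] [NormedAddCommGroup F] [NormedSpace ℝ F] [CompleteSpace F] (a b : ℝ)
    {g : E × ℝ → F} (hg : ContDiff ℝ ∞ g) : ContDiff ℝ ∞ (fun x => ∫ t in a..b, g (x, t)) :=
  contDiff_infty.2 fun n => contDiff_intervalIntegral_nat a b n (hg.of_le (by exact_mod_cast le_top))

/-- A vector field that is smooth near a compact set agrees there with a bounded Lipschitz field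
which is everywhere a multiple of the given one. -/
theorem exists_lipschitz_cutoff {E : Type*} [NormedAddCommGroup E] [NormedSpace ℝ E]
    [FiniteDimensional ℝ E] {S V : Set E} (hS : IsCompact S) (hV : IsOpen V) (hSV : S ⊆ V)
    {f : E → E} (hf : ContDiffOn ℝ ∞ f V) :
    ∃ (χ : E → ℝ) (K L : NNReal), (∀ x ∈ S, χ x = 1) ∧ LipschitzWith K (fun x => χ x • f x) ∧
      ∀ x, ‖χ x • f x‖ ≤ L := by
  obtain ⟨δ, hδ, hδV⟩ := hS.exists_cthickening_subset_open hV hSV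
  have hSint : S ⊆ interior (Metric.cthickening δ S) :=
    (Metric.self_subset_thickening hδ S).trans
      (interior_maximal (Metric.thickening_subset_cthickening δ S) Metric.isOpen_thickening)
  obtain ⟨χ, hχ1, hχ0, -⟩ := exists_contMDiffMap_one_nhds_of_subset_interior
    (modelWithCornersSelf ℝ E) (n := ⊤) hS.isClosed hSint
  have hχs : ContDiff ℝ ∞ χ := χ.contMDiff.contDiff
  have hcpt : IsCompact (Metric.cthickening δ S) := hS.cthickening
  have hsupp : HasCompactSupport (fun x => χ x • f x) :=
    HasCompactSupport.intro hcpt fun x hx => by rw [hχ0 x hx, zero_smul]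
  have hsm : ContDiff ℝ ∞ (fun x => χ x • f x) := by
    rw [contDiff_iff_contDiffAt]
    intro x
    by_cases hx : x ∈ V
    · exact hχs.contDiffAt.smul (hf.contDiffAt (hV.mem_nhds hx))
    · refine contDiffAt_const (c := (0 : E)).congr_of_eventuallyEq ?_
      filter_upwards [Metric.isClosed_cthickening.isOpen_compl.mem_nhds
        (fun h => hx (hδV h))] with y hy
      rw [hχ0 y hy, zero_smul]
  obtain ⟨K, hK⟩ := hsm.lipschitzWith_of_hasCompactSupport hsupp (by simp)
  obtain ⟨L, hL⟩ := hsupp.exists_bound_of_continuous hsm.continuous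
  refine ⟨χ, K, L.toNNReal, fun x hx => hχ1.self_of_nhdsSet x hx, hK, fun x => ?_⟩
  exact (hL x).trans (Real.le_coe_toNNReal L)

/-! ### Splitting the Hamiltonian along the collar -/

/-- A splitting `H s w = F (‖w‖²) + K s w` of a Hamiltonian on the disc into a radial autonomous
part and a part supported away from the boundary. -/
structure IsCollarSplitting (H : ℝ → ℂ → ℝ) (F : ℝ → ℝ) (K : ℝ → ℂ → ℝ) (r : ℝ) : Prop where
  pos : 0 < r
  lt_one : r < 1
  smooth_radial : ContDiffOn ℝ ∞ F (Set.Iic 1)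
  smooth : ContDiff ℝ ∞ (fun q : ℝ × ℂ => K q.1 q.2)
  periodic : ∀ s w, K (s + 2 * Real.pi) w = K s w
  support : ∀ s w, r ≤ ‖w‖ → K s w = 0
  eq : ∀ s w, ‖w‖ ≤ 1 → H s w = F (‖w‖ ^ 2) + K s w

/-- The profile is `H 0 (√t)` times a cutoff. The cutoff removes a neighbourhood of `t = 0`, where
the square root is not smooth, and equals `1` on the part of the collar where the identity is
claimed. -/
lemma exists_radial_profile {H : ℝ → ℂ → ℝ}
    (hsmooth : ContDiffOn ℝ ∞ (fun p : ℝ × ℂ => H p.1 p.2) (Set.univ ×ˢ closedDisc))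
    (hcollar : IsAutonomousRadialOnCollar H) :
    ∃ (F : ℝ → ℝ) (r : ℝ), 0 < r ∧ r < 1 ∧ ContDiffOn ℝ ∞ F (Set.Iic 1) ∧
      ∀ s w, r ≤ ‖w‖ → ‖w‖ ≤ 1 → H s w = F (‖w‖ ^ 2) := by
  obtain ⟨r₀, hr₀, f, hf⟩ := hcollar
  -- The bound `1 / 2` keeps the transition zone `c² ≤ t ≤ r²` away from `0`.
  set a := max r₀ (1 / 2) with ha
  have ha1 : a < 1 := max_lt hr₀ (by norm_num)
  have ha0 : 1 / 2 ≤ a := le_max_right _ _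
  have har : r₀ ≤ a := le_max_left _ _
  obtain ⟨c, hac, hc1⟩ := exists_between ha1
  obtain ⟨r, hcr, hr1⟩ := exists_between hc1
  have hcr2 : c ^ 2 < r ^ 2 := by nlinarith
  let χ : ℝ → ℝ := fun t => Real.smoothTransition ((t - c ^ 2) / (r ^ 2 - c ^ 2))
  have hχ : ContDiff ℝ ∞ χ :=
    Real.smoothTransition.contDiff.comp ((contDiff_id.sub contDiff_const).div_const _)
  refine ⟨fun t => χ t * H 0 (Real.sqrt t : ℂ), r, by linarith, hr1, ?_, ?_⟩
  · intro t ht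
    rcases lt_or_ge t (c ^ 2) with h | h
    · refine (contDiffAt_const (c := (0 : ℝ)).congr_of_eventuallyEq ?_).contDiffWithinAt
      filter_upwards [Iio_mem_nhds h] with x hx
      have : χ x = 0 := Real.smoothTransition.zero_of_nonpos
        (div_nonpos_of_nonpos_of_nonneg (by linarith [Set.mem_Iio.1 hx]) (by linarith))
      rw [this, zero_mul]
    · have ht0 : t ≠ 0 := by nlinarith
      refine hχ.contDiffAt.contDiffWithinAt.mul ?_
      have h1 : ContDiffWithinAt ℝ ∞ (fun x : ℝ => ((0 : ℝ), (Real.sqrt x : ℂ))) (Set.Iic 1) t :=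
        (contDiffAt_const.prodMk (Complex.ofRealCLM.contDiff.contDiffAt.comp t
          (Real.contDiffAt_sqrt ht0))).contDiffWithinAt
      refine ContDiffWithinAt.comp (g := fun p : ℝ × ℂ => H p.1 p.2)
        (t := Set.univ ×ˢ closedDisc) t ?_ h1 ?_
      · apply hsmooth
        refine ⟨trivial, ?_⟩
        simpa [closedDisc, abs_of_nonneg (Real.sqrt_nonneg t)] using ht
      · intro x hx
        refine ⟨trivial, ?_⟩
        simpa [closedDisc, abs_of_nonneg (Real.sqrt_nonneg x)] using hx
  · intro s w hw hw1
    have h1 : χ (‖w‖ ^ 2) = 1 := Real.smoothTransition.one_of_one_le (by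
      rw [le_div_iff₀ (by linarith)]; nlinarith)
    have hn : ‖((‖w‖ : ℝ) : ℂ)‖ = ‖w‖ := by simp
    simp only [h1, one_mul, Real.sqrt_sq (norm_nonneg w)]
    rw [hf s w (by simpa [closedDisc] using hw1) (by linarith),
      hf 0 (‖w‖ : ℂ) (by simpa [closedDisc] using hw1) (by rw [hn]; linarith), hn]

/-- The remainder vanishes for `r ≤ ‖w‖`, so its extension by zero outside the disc is smooth on all
of `ℂ`. -/
lemma exists_collarSplitting {H : ℝ → ℂ → ℝ}
    (hsmooth : ContDiffOn ℝ ∞ (fun p : ℝ × ℂ => H p.1 p.2) (Set.univ ×ˢ closedDisc))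
    (hperiodic : ∀ s : ℝ, ∀ z ∈ closedDisc, H (s + 2 * Real.pi) z = H s z)
    (hcollar : IsAutonomousRadialOnCollar H) :
    ∃ F K r, IsCollarSplitting H F K r := by
  obtain ⟨F, r, hr0, hr1, hF, hHF⟩ := exists_radial_profile hsmooth hcollar
  refine ⟨F, fun s w => if ‖w‖ ≤ 1 then H s w - F (‖w‖ ^ 2) else 0, r,
    ⟨hr0, hr1, hF, ?_, ?_, ?_, ?_⟩⟩
  · rw [contDiff_iff_contDiffAt]
    rintro ⟨s, w⟩
    rcases lt_or_ge r ‖w‖ with h | h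
    · refine (contDiffAt_const (c := (0 : ℝ))).congr_of_eventuallyEq ?_
      have hcont : Continuous fun q : ℝ × ℂ => ‖q.2‖ := by fun_prop
      filter_upwards [hcont.continuousAt.eventually (lt_mem_nhds h)] with q hq
      split_ifs with hq1
      · rw [hHF _ _ hq.le hq1, sub_self]
      · rfl
    · have hcont : Continuous fun q : ℝ × ℂ => ‖q.2‖ := by fun_prop
      have hev : ∀ᶠ q : ℝ × ℂ in nhds (s, w), ‖q.2‖ < 1 :=
        hcont.continuousAt.eventually (gt_mem_nhds (h.trans_lt hr1))
      have hmem : Set.univ ×ˢ closedDisc ∈ nhds (s, w) := by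
        filter_upwards [hev] with q hq
        exact ⟨trivial, by simpa [closedDisc] using hq.le⟩
      have h1 : ContDiffAt ℝ ∞ (fun q : ℝ × ℂ => H q.1 q.2 - F (‖q.2‖ ^ 2)) (s, w) := by
        refine (hsmooth.contDiffAt hmem).sub ?_
        have hlt : ‖w‖ ^ 2 < 1 := by nlinarith [norm_nonneg w]
        exact (hF.contDiffAt (Iic_mem_nhds hlt)).comp (s, w)
          ((contDiff_snd.norm_sq ℝ).contDiffAt (x := (s, w)))
      refine h1.congr_of_eventuallyEq ?_
      filter_upwards [hev] with q hq
      rw [if_pos hq.le]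
  · intro s w
    split_ifs with h
    · rw [hperiodic s w (by simpa [closedDisc] using h)]
    · rfl
  · intro s w hw
    split_ifs with h
    · rw [hHF s w hw h, sub_self]
    · rfl
  · intro s w hw
    simp [if_pos hw]

/-! ### Hadamard division of the radial part -/

/-- The smooth function `z ↦ (F (1 - ‖z‖²) - F 1) / ‖z‖²`. -/
noncomputable def radialQuotient (F : ℝ → ℝ) (z : ℂ) : ℝ :=
  ∫ y in (0 : ℝ)..1, -(2 * y * derivWithin F (Set.Iic 1) (1 - y ^ 2 * ‖z‖ ^ 2))

/-- As `0 ≤ g`, the argument never leaves the half-line on which `F` is smooth, so the one-sided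
derivative causes no loss. -/
lemma contDiff_derivWithin_one_sub {E : Type*} [NormedAddCommGroup E] [NormedSpace ℝ E]
    {F : ℝ → ℝ} (hF : ContDiffOn ℝ ∞ F (Set.Iic 1)) {g : E → ℝ} (hg : ContDiff ℝ ∞ g)
    (h0 : ∀ x, 0 ≤ g x) : ContDiff ℝ ∞ (fun x => derivWithin F (Set.Iic 1) (1 - g x)) := by
  have h1 : ContDiffOn ℝ ∞ (derivWithin F (Set.Iic 1)) (Set.Iic 1) :=
    hF.derivWithin (uniqueDiffOn_Iic 1) (by simp)
  have h2 : ContDiff ℝ ∞ fun x => 1 - g x := contDiff_const.sub hg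
  rw [← contDiffOn_univ] at h2 ⊢
  exact h1.comp h2 fun x _ => by simpa using h0 x

lemma hasDerivAt_comp_one_sub {F : ℝ → ℝ} (hF : ContDiffOn ℝ ∞ F (Set.Iic 1)) {g : ℝ → ℝ}
    {g' t : ℝ} (hg : HasDerivAt g g' t) (h0 : ∀ x, 0 ≤ g x) :
    HasDerivAt (fun x => F (1 - g x)) (-(derivWithin F (Set.Iic 1) (1 - g t) * g')) t := by
  have h1 : HasDerivWithinAt F (derivWithin F (Set.Iic 1) (1 - g t)) (Set.Iic 1) (1 - g t) :=
    ((hF.differentiableOn (by simp)) (1 - g t) (by simpa using h0 t)).hasDerivWithinAt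
  have h2 : HasDerivAt (fun x => 1 - g x) (-g') t := hg.const_sub 1
  have h3 := h1.comp_hasDerivAt t h2 (Filter.Eventually.of_forall fun x => by simpa using h0 x)
  exact h3.congr_deriv (by ring)

lemma radialQuotient_contDiff {F : ℝ → ℝ} (hF : ContDiffOn ℝ ∞ F (Set.Iic 1)) :
    ContDiff ℝ ∞ (radialQuotient F) := by
  have hg : ContDiff ℝ ∞ fun q : ℂ × ℝ => q.2 ^ 2 * ‖q.1‖ ^ 2 :=
    (contDiff_snd.pow 2).mul (contDiff_fst.norm_sq ℝ)
  have h1 := contDiff_derivWithin_one_sub hF hg (fun q => by positivity)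
  exact contDiff_intervalIntegral 0 1
    (((contDiff_const.mul contDiff_snd).mul h1).neg :
      ContDiff ℝ ∞ fun q : ℂ × ℝ => -(2 * q.2 * derivWithin F (Set.Iic 1) (1 - q.2 ^ 2 * ‖q.1‖ ^ 2)))

/-- Fundamental theorem of calculus for `y ↦ F (1 - y² ‖z‖²)` on `[0, 1]`; its derivative carries
the factor `‖z‖²`. -/
lemma norm_sq_mul_radialQuotient {F : ℝ → ℝ} (hF : ContDiffOn ℝ ∞ F (Set.Iic 1)) (z : ℂ) :
    ‖z‖ ^ 2 * radialQuotient F z = F (1 - ‖z‖ ^ 2) - F 1 := by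
  have hd : ∀ y : ℝ, HasDerivAt (fun y : ℝ => F (1 - y ^ 2 * ‖z‖ ^ 2))
      (‖z‖ ^ 2 * -(2 * y * derivWithin F (Set.Iic 1) (1 - y ^ 2 * ‖z‖ ^ 2))) y := by
    intro y
    have h := hasDerivAt_comp_one_sub hF (((hasDerivAt_pow 2 y).mul_const (‖z‖ ^ 2)))
      (fun y => by positivity)
    convert h using 1
    push_cast
    ring
  have hg : ContDiff ℝ ∞ fun y : ℝ => y ^ 2 * ‖z‖ ^ 2 := (contDiff_id.pow 2).mul contDiff_const
  have hc := (contDiff_derivWithin_one_sub hF hg (fun q => by positivity)).continuous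
  have h := intervalIntegral.integral_eq_sub_of_hasDerivAt (a := 0) (b := 1) (fun y _ => hd y)
    (Continuous.intervalIntegrable (by fun_prop) _ _)
  rw [intervalIntegral.integral_const_mul] at h
  rw [radialQuotient, h]
  simp

/-- Differentiate `norm_sq_mul_radialQuotient` along the ray `t ↦ t • z` at `t = 1` and cancel
`‖z‖²`, whence the condition `z ≠ 0`. -/
lemma radialQuotient_add_radial_deriv {F : ℝ → ℝ} (hF : ContDiffOn ℝ ∞ F (Set.Iic 1)) {z : ℂ}
    (hz : z ≠ 0) : 2 * radialQuotient F z + fderiv ℝ (radialQuotient F) z z =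
      -(2 * derivWithin F (Set.Iic 1) (1 - ‖z‖ ^ 2)) := by
  have hG : HasFDerivAt (radialQuotient F) (fderiv ℝ (radialQuotient F) z) z :=
    (radialQuotient_contDiff hF).differentiable (by simp) z |>.hasFDerivAt
  have hcurve : HasDerivAt (fun t : ℝ => t • z) z 1 := by
    simpa using (hasDerivAt_id (1 : ℝ)).smul_const z
  have hG1 : HasDerivAt (fun t : ℝ => radialQuotient F (t • z)) (fderiv ℝ (radialQuotient F) z z) 1 :=
    HasFDerivAt.comp_hasDerivAt (l := radialQuotient F) (f := fun t : ℝ => t • z) 1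
      (by simpa using hG) hcurve
  have hsq : HasDerivAt (fun t : ℝ => t ^ 2 * ‖z‖ ^ 2) (2 * ‖z‖ ^ 2) 1 := by
    simpa using (hasDerivAt_pow 2 (1 : ℝ)).mul_const (‖z‖ ^ 2)
  have hF1 := (hasDerivAt_comp_one_sub hF hsq (fun y => by positivity)).sub_const (F 1)
  have hprod := hsq.mul hG1
  have heq : (fun t : ℝ => F (1 - t ^ 2 * ‖z‖ ^ 2) - F 1) =
      fun t : ℝ => t ^ 2 * ‖z‖ ^ 2 * radialQuotient F (t • z) := by
    funext t
    have h := norm_sq_mul_radialQuotient hF (t • z)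
    rw [norm_smul, Real.norm_eq_abs, mul_pow, sq_abs] at h
    exact h.symm
  rw [heq] at hF1
  have h := hprod.unique hF1
  have hz2 : ‖z‖ ^ 2 ≠ 0 := by positivity
  apply mul_left_cancel₀ hz2
  simp at h
  linarith

/-! ### The coefficient `b`: smoothness, contact density, kernel -/

/-- The function `K_s(z₁ e^{-iks}) / |z₂|²` on `ℂ²`, where `s = arg z₂`. -/
noncomputable def twistedPart (K : ℝ → ℂ → ℝ) (k : ℕ) (p : CTwo) : ℝ :=
  K (p 1).arg (p 0 * Complex.exp (-(k * (p 1).arg : ℝ) * Complex.I)) / ‖p 1‖ ^ 2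

/-- The coefficient of `|z₂|² dθ₂` in the contact form. -/
noncomputable def bCoeff (F : ℝ → ℝ) (K : ℝ → ℂ → ℝ) (k : ℕ) (p : CTwo) : ℝ :=
  k + radialQuotient F (p 1) + twistedPart K k p

lemma norm_mul_exp_ofReal_mul_I (z : ℂ) (x : ℝ) : ‖z * Complex.exp (x * Complex.I)‖ = ‖z‖ := by
  rw [norm_mul, Complex.norm_exp_ofReal_mul_I, mul_one]

namespace IsCollarSplitting

variable {H : ℝ → ℂ → ℝ} {F : ℝ → ℝ} {K : ℝ → ℂ → ℝ} {r : ℝ}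

/-- Any angle of `z₂` may replace the principal argument: `K` is `2π`-periodic in `s`, and
`e^{-iks}` is too because `k` is an integer. -/
lemma twistedPart_eq (h : IsCollarSplitting H F K r) (k : ℕ) {p : CTwo} (hp : p 1 ≠ 0) {s : ℝ}
    (hs : p 1 = ‖p 1‖ * Complex.exp (s * Complex.I)) :
    twistedPart K k p = K s (p 0 * Complex.exp (-(k * s : ℝ) * Complex.I)) / ‖p 1‖ ^ 2 := by
  have h1 : Complex.exp ((p 1).arg * Complex.I) = Complex.exp (s * Complex.I) := by
    have hn : (‖p 1‖ : ℂ) ≠ 0 := by simpa using hp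
    apply mul_left_cancel₀ hn
    rw [Complex.norm_mul_exp_arg_mul_I, ← hs]
  obtain ⟨n, hn⟩ := Complex.exp_eq_exp_iff_exists_int.1 h1
  have harg : (p 1).arg = s + n * (2 * Real.pi) := by
    have h2 := congrArg Complex.im hn
    simpa using h2
  have hper : K (p 1).arg = K s := by
    have hf : Function.Periodic K (2 * Real.pi) := fun s => funext fun w => h.periodic s w
    rw [harg]
    exact hf.int_mul n s
  have hexp : Complex.exp (-(k * (p 1).arg : ℝ) * Complex.I) =
      Complex.exp (-(k * s : ℝ) * Complex.I) := by
    rw [Complex.exp_eq_exp_iff_exists_int]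
    refine ⟨-(k * n), ?_⟩
    rw [harg]
    push_cast
    ring
  rw [twistedPart, hper, hexp]

lemma twistedPart_eq_zero (h : IsCollarSplitting H F K r) (k : ℕ) {p : CTwo} (hp : r ≤ ‖p 0‖) :
    twistedPart K k p = 0 := by
  rw [twistedPart, h.support, zero_div]
  rw [← Complex.ofReal_neg, norm_mul_exp_ofReal_mul_I]
  exact hp

/-- The open set on which the contact form is smooth. -/
def smoothDomain (r : ℝ) : Set CTwo := {p | p 1 ≠ 0 ∨ r < ‖p 0‖}

lemma isOpen_smoothDomain (r : ℝ) : IsOpen (smoothDomain r) :=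
  ((coordCLM 1).continuous.isOpen_preimage _ isOpen_ne).union
    (isOpen_lt continuous_const (coordCLM 0).continuous.norm)

lemma sphereThree_subset_smoothDomain (hr : r < 1) : sphereThree ⊆ smoothDomain r := by
  intro p hp
  rw [mem_sphereThree] at hp
  by_cases h1 : p 1 = 0
  · right
    rw [h1] at hp
    simp at hp
    rcases hp with hp | hp <;> linarith [norm_nonneg (p 0)]
  · exact Or.inl h1

/-- Near the binding the function is zero. Elsewhere the jump of `arg` is harmless, since
`twistedPart_eq` allows a smooth local branch of the angle. -/
lemma twistedPart_contDiffAt (h : IsCollarSplitting H F K r) (k : ℕ) {p : CTwo}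
    (hp : p ∈ smoothDomain r) : ContDiffAt ℝ ∞ (twistedPart K k) p := by
  by_cases h1 : p 1 = 0
  · have hlt : r < ‖p 0‖ := hp.resolve_left (fun h => h h1)
    refine (contDiffAt_const (c := (0 : ℝ))).congr_of_eventuallyEq ?_
    filter_upwards [(coordCLM 0).continuous.norm.continuousAt.eventually (lt_mem_nhds hlt)]
      with q hq
    exact h.twistedPart_eq_zero k (le_of_lt hq)
  · set θ := (p 1).arg with hθ
    have hrot : p 1 * Complex.exp ((-θ : ℝ) * Complex.I) = ‖p 1‖ := by
      conv_lhs => rw [← Complex.norm_mul_exp_arg_mul_I (p 1), ← hθ]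
      rw [mul_assoc, ← Complex.exp_add]
      simp
    -- Rotating `z₂` by `-θ` makes it a positive real at `p`, where the principal logarithm is
    -- smooth.
    let S : CTwo → ℝ := fun q => (Complex.log (q 1 * Complex.exp ((-θ : ℝ) * Complex.I))).im + θ
    have hc0 : ContDiff ℝ ∞ (fun q : CTwo => q 0) := (coordCLM 0).contDiff
    have hc1 : ContDiff ℝ ∞ (fun q : CTwo => q 1) := (coordCLM 1).contDiff
    have hS : ContDiffAt ℝ ∞ S p := by
      have hmem : p 1 * Complex.exp ((-θ : ℝ) * Complex.I) ∈ Complex.slitPlane := by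
        rw [hrot]
        exact Complex.ofReal_mem_slitPlane.2 (norm_pos_iff.2 h1)
      have hlog : ContDiffAt ℝ ∞ Complex.log (p 1 * Complex.exp ((-θ : ℝ) * Complex.I)) :=
        (Complex.contDiffAt_log hmem).restrict_scalars ℝ
      exact (Complex.imCLM.contDiff.contDiffAt.comp p
        (hlog.comp p (hc1.contDiffAt.mul contDiffAt_const))).add contDiffAt_const
    have hSeq : ∀ q : CTwo, q 1 ≠ 0 → q 1 = ‖q 1‖ * Complex.exp (S q * Complex.I) := by
      intro q hq
      have h2 := Complex.norm_mul_exp_arg_mul_I (q 1 * Complex.exp ((-θ : ℝ) * Complex.I))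
      rw [norm_mul_exp_ofReal_mul_I] at h2
      have h3 : Complex.exp ((-θ : ℝ) * Complex.I) * Complex.exp (θ * Complex.I) = 1 := by
        rw [← Complex.exp_add]; simp
      have hSq : (S q : ℂ) = (q 1 * Complex.exp ((-θ : ℝ) * Complex.I)).arg + θ := by
        simp only [S, Complex.log_im]; push_cast; rfl
      rw [hSq, add_mul, Complex.exp_add, ← mul_assoc, h2, mul_assoc, h3, mul_one]
    have hk : ContDiffAt ℝ ∞ (fun q : CTwo =>
        K (S q) (q 0 * Complex.exp (-(k * S q : ℝ) * Complex.I)) / ‖q 1‖ ^ 2) p := by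
      have hinner : ContDiffAt ℝ ∞ (fun q : CTwo => (-(k * S q : ℝ) : ℂ) * Complex.I) p :=
        ((Complex.ofRealCLM.contDiff.contDiffAt.comp p (contDiffAt_const.mul hS)).neg).mul
          contDiffAt_const
      have hexp : ContDiff ℝ ∞ Complex.exp := Complex.contDiff_exp (𝕜 := ℂ) |>.restrict_scalars ℝ
      have hpair : ContDiffAt ℝ ∞ (fun q : CTwo =>
          (S q, q 0 * Complex.exp (-(k * S q : ℝ) * Complex.I))) p :=
        hS.prodMk (hc0.contDiffAt.mul (hexp.contDiffAt.comp p hinner))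
      refine ContDiffAt.div (h.smooth.contDiffAt.comp p hpair) (hc1.norm_sq ℝ).contDiffAt ?_
      simpa using h1
    refine hk.congr_of_eventuallyEq ?_
    filter_upwards [(coordCLM 1).continuous.continuousAt.eventually_ne h1] with q hq
    exact h.twistedPart_eq k hq (hSeq q hq)

lemma bCoeff_contDiffAt (h : IsCollarSplitting H F K r) (k : ℕ) {p : CTwo}
    (hp : p ∈ smoothDomain r) : ContDiffAt ℝ ∞ (bCoeff F K k) p :=
  (contDiffAt_const.add ((radialQuotient_contDiff h.smooth_radial).contDiffAt.comp p
    (coordCLM 1).contDiff.contDiffAt)).add (h.twistedPart_contDiffAt k hp)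

lemma differentiable_slice (h : IsCollarSplitting H F K r) (s : ℝ) : Differentiable ℝ (K s) :=
  (h.smooth.differentiable (by simp)).comp ((differentiable_const s).prodMk differentiable_id)

lemma fderiv_slice (h : IsCollarSplitting H F K r) (s : ℝ) (w u : ℂ) :
    fderiv ℝ (K s) w u = fderiv ℝ (fun q : ℝ × ℂ => K q.1 q.2) (s, w) (0, u) := by
  have h1 := ((h.smooth.differentiable (by simp)) (s, w)).hasFDerivAt.comp w
    (hasFDerivAt_prodMk_right s w)
  rw [show K s = (fun q : ℝ × ℂ => K q.1 q.2) ∘ fun w => (s, w) from rfl, h1.fderiv]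
  simp

lemma fderiv_twistedPart_zero (h : IsCollarSplitting H F K r) (k : ℕ) {p : CTwo} (hp : p 1 ≠ 0)
    {s : ℝ} (hs : p 1 = ‖p 1‖ * Complex.exp (s * Complex.I)) (u : ℂ) :
    fderiv ℝ (twistedPart K k) p (inclCLM 0 u) =
      fderiv ℝ (K s) (p 0 * Complex.exp (-(k * s : ℝ) * Complex.I))
        (u * Complex.exp (-(k * s : ℝ) * Complex.I)) / ‖p 1‖ ^ 2 := by
  have hd : HasFDerivAt (twistedPart K k) (fderiv ℝ (twistedPart K k) p) p :=
    ((h.twistedPart_contDiffAt k (Or.inl hp)).differentiableAt (by simp)).hasFDerivAt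
  have hc : HasDerivAt (fun t : ℝ => p + t • inclCLM 0 u) (inclCLM 0 u) 0 := by
    simpa using ((hasDerivAt_id (0 : ℝ)).smul_const (inclCLM 0 u)).const_add p
  have h1 : HasDerivAt (fun t : ℝ => twistedPart K k (p + t • inclCLM 0 u))
      (fderiv ℝ (twistedPart K k) p (inclCLM 0 u)) 0 :=
    HasFDerivAt.comp_hasDerivAt (l := twistedPart K k) (f := fun t : ℝ => p + t • inclCLM 0 u) 0
      (by simpa using hd) hc
  set E := Complex.exp (-(k * s : ℝ) * Complex.I) with hE
  have hc2 : HasDerivAt (fun t : ℝ => (p 0 + t • u) * E) (u * E) 0 := by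
    simpa using (((hasDerivAt_id (0 : ℝ)).smul_const u).const_add (p 0)).mul_const E
  have h2 : HasDerivAt (fun t : ℝ => K s ((p 0 + t • u) * E) / ‖p 1‖ ^ 2)
      (fderiv ℝ (K s) (p 0 * E) (u * E) / ‖p 1‖ ^ 2) 0 :=
    (HasFDerivAt.comp_hasDerivAt (l := K s) (f := fun t : ℝ => (p 0 + t • u) * E) 0
      (by simpa using (h.differentiable_slice s (p 0 * E)).hasFDerivAt) hc2).div_const _
  refine h1.unique (h2.congr_of_eventuallyEq (Filter.Eventually.of_forall fun t => ?_))
  have e0 : (p + t • inclCLM 0 u) 0 = p 0 + t • u := by simp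
  have e1 : (p + t • inclCLM 0 u) 1 = p 1 := by simp
  have := h.twistedPart_eq k (p := p + t • inclCLM 0 u) (by rw [e1]; exact hp)
    (s := s) (by rw [e1]; exact hs)
  rw [e0, e1] at this
  exact this

/-- Euler's identity: at fixed `z₁` the function is homogeneous of degree `-2` along positive rays
in `z₂`, on which the argument is constant. -/
lemma fderiv_twistedPart_radial (h : IsCollarSplitting H F K r) (k : ℕ) {p : CTwo}
    (hp : p 1 ≠ 0) :
    fderiv ℝ (twistedPart K k) p (inclCLM 1 (p 1)) = -2 * twistedPart K k p := by
  have hs := (Complex.norm_mul_exp_arg_mul_I (p 1)).symm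
  have hd : HasFDerivAt (twistedPart K k) (fderiv ℝ (twistedPart K k) p) p :=
    ((h.twistedPart_contDiffAt k (Or.inl hp)).differentiableAt (by simp)).hasFDerivAt
  have hc : HasDerivAt (fun t : ℝ => p + t • inclCLM 1 (p 1)) (inclCLM 1 (p 1)) 0 := by
    simpa using ((hasDerivAt_id (0 : ℝ)).smul_const (inclCLM 1 (p 1))).const_add p
  have h1 : HasDerivAt (fun t : ℝ => twistedPart K k (p + t • inclCLM 1 (p 1)))
      (fderiv ℝ (twistedPart K k) p (inclCLM 1 (p 1))) 0 :=
    HasFDerivAt.comp_hasDerivAt (l := twistedPart K k)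
      (f := fun t : ℝ => p + t • inclCLM 1 (p 1)) 0 (by simpa using hd) hc
  have h2 : HasDerivAt (fun t : ℝ => twistedPart K k p * ((1 + t) ^ 2)⁻¹)
      (-2 * twistedPart K k p) 0 := by
    have h3 : HasDerivAt (fun t : ℝ => (1 + t) ^ 2) 2 0 := by
      exact (((hasDerivAt_id (0 : ℝ)).const_add 1).pow 2).congr_deriv (by simp)
    exact ((h3.inv (by simp)).const_mul (twistedPart K k p)).congr_deriv (by simp; ring)
  refine h1.unique (h2.congr_of_eventuallyEq ?_)
  filter_upwards [Ioi_mem_nhds (show (-1 : ℝ) < 0 by norm_num)] with t ht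
  have ht : 0 < 1 + t := by linarith [Set.mem_Ioi.1 ht]
  have e0 : (p + t • inclCLM 1 (p 1)) 0 = p 0 := by simp
  have e1 : (p + t • inclCLM 1 (p 1)) 1 = ((1 + t : ℝ) : ℂ) * p 1 := by simp; ring
  have hn : ‖((1 + t : ℝ) : ℂ) * p 1‖ = (1 + t) * ‖p 1‖ := by
    rw [norm_mul, Complex.norm_of_nonneg ht.le]
  have harg : (((1 + t : ℝ) : ℂ) * p 1).arg = (p 1).arg := Complex.arg_real_mul _ ht
  simp only [twistedPart, e0, e1, hn, harg]
  field_simp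

lemma fderiv_bCoeff (h : IsCollarSplitting H F K r) (k : ℕ) {p : CTwo} (hp : p ∈ smoothDomain r)
    (v : CTwo) : fderiv ℝ (bCoeff F K k) p v =
      fderiv ℝ (radialQuotient F) (p 1) (v 1) + fderiv ℝ (twistedPart K k) p v := by
  have h1 : HasFDerivAt (fun q : CTwo => radialQuotient F (q 1))
      ((fderiv ℝ (radialQuotient F) (p 1)).comp (coordCLM 1)) p :=
    HasFDerivAt.comp (g := radialQuotient F) p
      ((radialQuotient_contDiff h.smooth_radial).differentiable (by simp) _).hasFDerivAt
      (coordCLM 1).hasFDerivAt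
  have h2 : HasFDerivAt (twistedPart K k) (fderiv ℝ (twistedPart K k) p) p :=
    ((h.twistedPart_contDiffAt k hp).differentiableAt (by simp)).hasFDerivAt
  have h3 : HasFDerivAt (bCoeff F K k) _ p := (h1.const_add (k : ℝ)).add h2
  rw [h3.fderiv]
  simp

/-- The factor `1 / |z₂|²` cancels because `1 - |z₁|² = |z₂|²` on the sphere. What remains is
bounded near the binding and, apart from `2k`, involves `k` only through the point `w`. -/
lemma contactDensity_bCoeff (h : IsCollarSplitting H F K r) (k : ℕ) {p : CTwo}
    (hp : p ∈ sphereThree) (h1 : p 1 ≠ 0) {s : ℝ}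
    (hs : p 1 = ‖p 1‖ * Complex.exp (s * Complex.I)) {w : ℂ}
    (hw : w = p 0 * Complex.exp (-(k * s : ℝ) * Complex.I)) :
    contactDensity (bCoeff F K k) p = 2 * k + (2 * radialQuotient F (p 1) +
      ‖p 0‖ ^ 2 * fderiv ℝ (radialQuotient F) (p 1) (p 1)) +
      (2 * K s w - fderiv ℝ (K s) w w) := by
  have hd : p ∈ smoothDomain r := Or.inl h1
  rw [contactDensity, h.fderiv_bCoeff k hd, h.fderiv_bCoeff k hd,
    h.fderiv_twistedPart_radial k h1, h.fderiv_twistedPart_zero k h1 hs, bCoeff,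
    h.twistedPart_eq k h1 hs, ← hw]
  rw [mem_sphereThree] at hp
  have hn : ‖p 1‖ ≠ 0 := norm_ne_zero_iff.2 h1
  simp
  field_simp
  linear_combination (-2 * K s w) * hp

lemma contactDensity_bCoeff_of_eq_zero (k : ℕ) {p : CTwo} (h1 : p 1 = 0) :
    contactDensity (bCoeff F K k) p = 2 * k + (2 * radialQuotient F (p 1) +
      ‖p 0‖ ^ 2 * fderiv ℝ (radialQuotient F) (p 1) (p 1)) := by
  -- At `z₂ = 0` the quotient in `twistedPart` is `0` by the convention for division by zero, and
  -- the derivative terms have vanishing factors or arguments.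
  rw [contactDensity, bCoeff, twistedPart, h1]
  simp
  ring

lemma exists_contactDensity_ge (h : IsCollarSplitting H F K r) :
    ∃ k : ℕ, ∀ p ∈ sphereThree, 2 ≤ contactDensity (bCoeff F K k) p := by
  have hG := radialQuotient_contDiff h.smooth_radial
  have hG' : Continuous fun z : ℂ => fderiv ℝ (radialQuotient F) z z :=
    (hG.continuous_fderiv (by simp)).clm_apply continuous_id
  have hK' : Continuous fun q : ℝ × ℂ => 2 * K q.1 q.2 - fderiv ℝ (K q.1) q.2 q.2 := by
    simp only [h.fderiv_slice]
    exact (continuous_const.mul h.smooth.continuous).sub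
      ((h.smooth.continuous_fderiv (by simp)).clm_apply (by fun_prop))
  obtain ⟨M₁, hM₁⟩ := ((isCompact_closedBall (0 : ℂ) 1).prod
    (isCompact_Icc (a := (0 : ℝ)) (b := 1))).exists_bound_of_continuousOn
    (f := fun q : ℂ × ℝ => 2 * radialQuotient F q.1 +
      q.2 * fderiv ℝ (radialQuotient F) q.1 q.1)
    ((continuous_const.mul (hG.continuous.comp continuous_fst)).add
      (continuous_snd.mul (hG'.comp continuous_fst))).continuousOn
  -- Bounding over all `(s, w)` rather than over `p` makes `M₂` independent of `k`, which is chosen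
  -- only afterwards.
  obtain ⟨M₂, hM₂⟩ := ((isCompact_Icc (a := -Real.pi) (b := Real.pi)).prod
    (isCompact_closedBall (0 : ℂ) 1)).exists_bound_of_continuousOn hK'.continuousOn
  obtain ⟨k, hk⟩ := exists_nat_ge (2 + M₁ + |M₂|)
  refine ⟨k, fun p hp => ?_⟩
  have hp' := mem_sphereThree.1 hp
  have hp1 : ‖p 1‖ ≤ 1 := by nlinarith [norm_nonneg (p 1), sq_nonneg ‖p 0‖]
  have hp0 : ‖p 0‖ ≤ 1 := by nlinarith [norm_nonneg (p 0), sq_nonneg ‖p 1‖]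
  have b1 := abs_le.1 (hM₁ (p 1, ‖p 0‖ ^ 2) ⟨by simpa using hp1, by positivity, by nlinarith⟩)
  dsimp only at b1
  have hk0 : (0 : ℝ) ≤ k := by positivity
  by_cases h1 : p 1 = 0
  · rw [contactDensity_bCoeff_of_eq_zero k h1]
    linarith [abs_nonneg M₂, b1.1]
  · have hs := (Complex.norm_mul_exp_arg_mul_I (p 1)).symm
    rw [h.contactDensity_bCoeff k hp h1 hs rfl]
    have b2 := abs_le.1 (hM₂ ((p 1).arg, p 0 * Complex.exp (-(k * (p 1).arg : ℝ) * Complex.I))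
      ⟨⟨(Complex.neg_pi_lt_arg _).le, Complex.arg_le_pi _⟩, by
        rw [mem_closedBall_zero_iff, ← Complex.ofReal_neg, norm_mul_exp_ofReal_mul_I]
        exact hp0⟩)
    dsimp only at b2
    linarith [le_abs_self M₂, b1.1, b2.1]

lemma fderivWithin_hamiltonian (h : IsCollarSplitting H F K r) (s : ℝ) {w : ℂ} (hw : ‖w‖ < 1)
    (Y : ℂ) : fderivWithin ℝ (H s) closedDisc w Y =
      2 * derivWithin F (Set.Iic 1) (‖w‖ ^ 2) * (w.re * Y.re + w.im * Y.im) +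
        fderiv ℝ (K s) w Y := by
  have hlt : ‖w‖ ^ 2 < 1 := by nlinarith [norm_nonneg w]
  have hmem : closedDisc ∈ nhds w := Metric.closedBall_mem_nhds_of_mem (by simpa using hw)
  have hF : HasDerivAt F (derivWithin F (Set.Iic 1) (‖w‖ ^ 2)) (‖w‖ ^ 2) :=
    (h.smooth_radial.differentiableOn (by simp) _ hlt.le).hasDerivWithinAt.hasDerivAt
      (Iic_mem_nhds hlt)
  have hN : HasFDerivAt (fun z : ℂ => ‖z‖ ^ 2) (2 • innerSL ℝ w) w :=
    (hasStrictFDerivAt_norm_sq w).hasFDerivAt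
  have h1 := (hF.comp_hasFDerivAt w hN).add (h.differentiable_slice s w).hasFDerivAt
  have h2 : HasFDerivAt (H s) _ w := h1.congr_of_eventuallyEq (by
    filter_upwards [hmem] with z hz
    exact h.eq s z (by simpa [closedDisc] using hz))
  rw [fderivWithin_of_mem_nhds hmem, h2.fderiv]
  simp [Complex.inner]
  ring

/-- The vector field `kernelField` in the coordinates given by the solid torus. -/
lemma kernelField_bCoeff (h : IsCollarSplitting H F K r) (k : ℕ) {p : CTwo}
    (hp : p ∈ sphereThree) (h1 : p 1 ≠ 0) {s : ℝ}
    (hs : p 1 = ‖p 1‖ * Complex.exp (s * Complex.I)) {w X : ℂ}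
    (hw : p 0 = w * Complex.exp ((k * s : ℝ) * Complex.I))
    (hX : ∀ Y, discAreaForm X Y = fderivWithin ℝ (H s) closedDisc w Y) :
    kernelField (bCoeff F K k) p =
      pairC (2 * (X * Complex.exp ((k * s : ℝ) * Complex.I) + Complex.I * k * p 0))
        (2 * (Complex.I - ((w.re * X.re + w.im * X.im) / ‖p 1‖ ^ 2 : ℝ)) * p 1) := by
  have hd : p ∈ smoothDomain r := Or.inl h1
  have hn : ‖p 1‖ ≠ 0 := norm_ne_zero_iff.2 h1
  have hwn : ‖w‖ = ‖p 0‖ := by rw [hw, norm_mul_exp_ofReal_mul_I]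
  have hp' := mem_sphereThree.1 hp
  have hw1 : ‖w‖ < 1 := by
    rw [hwn]
    nlinarith [norm_nonneg (p 0), sq_nonneg (‖p 0‖ - 1), pow_pos (norm_pos_iff.2 h1) 2]
  have hsq : 1 - ‖p 1‖ ^ 2 = ‖w‖ ^ 2 := by rw [hwn]; linarith
  set E := Complex.exp (-(k * s : ℝ) * Complex.I) with hE
  set E' := Complex.exp ((k * s : ℝ) * Complex.I) with hE'
  have hEE : E' * E = 1 := by rw [hE, hE', ← Complex.exp_add]; simp
  have hconj : E' = starRingEnd ℂ E := by
    rw [hE, hE', ← Complex.exp_conj]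
    simp
  have hwE : p 0 * E = w := by rw [hw, mul_assoc, hEE, mul_one]
  set f := derivWithin F (Set.Iic 1) (‖w‖ ^ 2) with hf
  -- The Hamilton equation expresses `dK_s` through `X` and `F'`, so that no derivative of `K`
  -- survives in the kernel field.
  have hK : ∀ Y, fderiv ℝ (K s) w Y =
      2 * (X.re * Y.im - X.im * Y.re) - 2 * f * (w.re * Y.re + w.im * Y.im) := by
    intro Y
    have h2 := hX Y
    rw [h.fderivWithin_hamiltonian s hw1, discAreaForm] at h2
    linarith
  have hL0 : ∀ u, fderiv ℝ (bCoeff F K k) p (inclCLM 0 u) =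
      (2 * (X.re * (u * E).im - X.im * (u * E).re) -
        2 * f * (w.re * (u * E).re + w.im * (u * E).im)) / ‖p 1‖ ^ 2 := by
    intro u
    rw [h.fderiv_bCoeff k hd, h.fderiv_twistedPart_zero k h1 hs, hwE, hK, inclCLM_zero_one,
      map_zero, zero_add]
  -- The twisted part drops out by its homogeneity of degree `-2`.
  have hL1 : 2 * bCoeff F K k p + fderiv ℝ (bCoeff F K k) p (inclCLM 1 (p 1)) = 2 * k - 2 * f := by
    have h2 := radialQuotient_add_radial_deriv h.smooth_radial h1
    rw [hsq, ← hf] at h2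
    rw [h.fderiv_bCoeff k hd, h.fderiv_twistedPart_radial k h1, bCoeff, inclCLM_one_one]
    linarith
  rw [kernelField, hL1, hL0, hL0, hL0, mul_assoc Complex.I (p 0) E, hwE]
  congr 1
  · have hne : ((‖p 1‖ ^ 2 : ℝ) : ℂ) ≠ 0 := by exact_mod_cast pow_ne_zero 2 hn
    rw [Complex.ofReal_div, Complex.ofReal_div, div_mul_eq_mul_div, ← add_div,
      mul_div_cancel₀ _ hne, hw, hconj]
    apply Complex.ext
    · simp
      ring
    · simp
      ring
  · congr 1
    have h2 : 2 * (X.re * (Complex.I * w).im - X.im * (Complex.I * w).re) -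
        2 * f * (w.re * (Complex.I * w).re + w.im * (Complex.I * w).im) =
        2 * (w.re * X.re + w.im * X.im) := by
      simp
      ring
    rw [h2]
    push_cast
    ring

end IsCollarSplitting

/-! ### The page and its radial reparametrisation -/

/-- The page `Σ` of the open book, parametrized by inverse stereographic projection. -/
noncomputable def pageMap (w : ℂ) : CTwo :=
  pairC ((2 / (1 + ‖w‖ ^ 2) : ℝ) • w) ((1 - ‖w‖ ^ 2) / (1 + ‖w‖ ^ 2) : ℝ)

/-- The radial reparametrization identifying `pageMap` with `z ↦ (z, √(1 - ‖z‖²))`. -/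
noncomputable def discReparam (z : ℂ) : ℂ := (1 / (1 + Real.sqrt (1 - ‖z‖ ^ 2)) : ℝ) • z

lemma norm_sq_lt_one_iff {z : ℂ} : ‖z‖ ^ 2 < 1 ↔ ‖z‖ < 1 := by
  rw [sq_lt_one_iff₀ (norm_nonneg z)]

lemma mem_openDisc {z : ℂ} : z ∈ openDisc ↔ ‖z‖ < 1 := by simp [openDisc]

lemma mem_closedDisc {z : ℂ} : z ∈ closedDisc ↔ ‖z‖ ≤ 1 := by simp [closedDisc]

lemma contDiff_two_div : ContDiff ℝ ∞ fun w : ℂ => (2 / (1 + ‖w‖ ^ 2) : ℝ) • w := by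
  have h1 : ContDiff ℝ ∞ fun w : ℂ => (1 + ‖w‖ ^ 2 : ℝ) := contDiff_const.add (contDiff_id.norm_sq ℝ)
  exact (contDiff_const.div h1 (fun w => by positivity)).smul contDiff_id

lemma pageMap_contDiff : ContDiff ℝ ∞ pageMap := by
  have h1 : ContDiff ℝ ∞ fun w : ℂ => (‖w‖ ^ 2 : ℝ) := contDiff_id.norm_sq ℝ
  exact ((inclCLM 0).contDiff.comp contDiff_two_div).add ((inclCLM 1).contDiff.comp
    (Complex.ofRealCLM.contDiff.comp ((contDiff_const.sub h1).div (contDiff_const.add h1)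
      (fun w => by positivity))))

lemma pageMap_mem (w : ℂ) : pageMap w ∈ sphereThree := by
  rw [mem_sphereThree, pageMap, pairC_zero, pairC_one, norm_smul, Complex.norm_real,
    Real.norm_eq_abs, Real.norm_eq_abs, mul_pow, sq_abs, sq_abs]
  field_simp
  ring

/-- Stereographic projection, a left inverse of `pageMap`. -/
lemma pageMap_leftInverse (w : ℂ) : pageMap w 0 / (1 + pageMap w 1) = w := by
  have h : (1 + (‖w‖ : ℂ) ^ 2) ≠ 0 := by
    have : (1 + ‖w‖ ^ 2 : ℝ) ≠ 0 := by positivity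
    exact_mod_cast this
  rw [pageMap, pairC_zero, pairC_one, Complex.real_smul]
  push_cast
  have h2 : (1 : ℂ) + (1 - (‖w‖ : ℂ) ^ 2) / (1 + (‖w‖ : ℂ) ^ 2) = 2 / (1 + (‖w‖ : ℂ) ^ 2) := by
    field_simp
    ring
  rw [h2]
  field_simp

lemma fderiv_injective_of_leftInverse {E F : Type*} [NormedAddCommGroup E] [NormedSpace ℝ E]
    [NormedAddCommGroup F] [NormedSpace ℝ F] {f : E → F} {g : F → E} {x : E}
    (hf : DifferentiableAt ℝ f x) (hg : DifferentiableAt ℝ g (f x))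
    (h : ∀ᶠ y in nhds x, g (f y) = y) : Function.Injective (fderiv ℝ f x) := by
  have h1 : HasFDerivAt (fun y => g (f y)) ((fderiv ℝ g (f x)).comp (fderiv ℝ f x)) x :=
    hg.hasFDerivAt.comp x hf.hasFDerivAt
  have h2 : HasFDerivAt (fun y => g (f y)) (ContinuousLinearMap.id ℝ E) x :=
    (hasFDerivAt_id x).congr_of_eventuallyEq h
  have h3 := h1.unique h2
  intro u v huv
  have hu := congrArg (fun L : E →L[ℝ] E => L u) h3
  have hv := congrArg (fun L : E →L[ℝ] E => L v) h3
  simp at hu hv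
  rw [← hu, ← hv, huv]

lemma fderivWithin_pageMap {z : ℂ} (hz : z ∈ closedDisc) :
    fderivWithin ℝ pageMap closedDisc z = fderiv ℝ pageMap z := by
  refine fderivWithin_eq_fderiv ?_ (pageMap_contDiff.differentiable (by simp) z)
  exact uniqueDiffOn_convex (convex_closedBall 0 1)
    ⟨0, Metric.ball_subset_interior_closedBall (by simp)⟩ z hz

lemma pageMap_isSmoothDiscEmbedding : IsSmoothDiscEmbedding pageMap where
  smooth := pageMap_contDiff.contDiffOn
  mapsTo := fun w _ => pageMap_mem w
  injective := fun w _ w' _ h => by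
    rw [← pageMap_leftInverse w, ← pageMap_leftInverse w', h]
  immersion := fun z hz => by
    rw [fderivWithin_pageMap hz]
    have hne : 1 + pageMap z 1 ≠ 0 := by
      have : (1 + (1 - ‖z‖ ^ 2) / (1 + ‖z‖ ^ 2) : ℝ) ≠ 0 := by
        have h2 : (1 + (1 - ‖z‖ ^ 2) / (1 + ‖z‖ ^ 2) : ℝ) = 2 / (1 + ‖z‖ ^ 2) := by
          field_simp
          ring
        rw [h2]
        positivity
      rw [pageMap, pairC_one, ← Complex.ofReal_one, ← Complex.ofReal_add]
      exact Complex.ofReal_ne_zero.2 this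
    have h0 : DifferentiableAt ℝ (fun q : CTwo => q 0) (pageMap z) := (coordCLM 0).differentiableAt
    have h1 : DifferentiableAt ℝ (fun q : CTwo => q 1) (pageMap z) := (coordCLM 1).differentiableAt
    refine fderiv_injective_of_leftInverse (g := fun q : CTwo => q 0 / (1 + q 1))
      (pageMap_contDiff.differentiable (by simp) z) ?_
      (Filter.Eventually.of_forall pageMap_leftInverse)
    have h2 : DifferentiableAt ℝ (fun q : CTwo => 1 + q 1) (pageMap z) := h1.const_add 1
    simp only [div_eq_mul_inv]
    exact h0.mul (h2.inv hne)

lemma norm_sq_discReparam {z : ℂ} (hz : ‖z‖ ≤ 1) : ‖discReparam z‖ ^ 2 =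
    (1 - Real.sqrt (1 - ‖z‖ ^ 2)) / (1 + Real.sqrt (1 - ‖z‖ ^ 2)) := by
  have h0 := Real.sqrt_nonneg (1 - ‖z‖ ^ 2)
  have h1 := Real.sq_sqrt (show 0 ≤ 1 - ‖z‖ ^ 2 by nlinarith [norm_nonneg z])
  rw [discReparam, norm_smul, Real.norm_eq_abs, mul_pow, sq_abs]
  field_simp
  nlinarith

/-- This is the point of `discReparam`: in the new coordinate the page is the graph over the
`z₁`-disc, which is where the suspension of the isotopy starts and ends. -/
lemma pageMap_discReparam {z : ℂ} (hz : ‖z‖ ≤ 1) :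
    pageMap (discReparam z) = pairC z (Real.sqrt (1 - ‖z‖ ^ 2) : ℝ) := by
  have h0 := Real.sqrt_nonneg (1 - ‖z‖ ^ 2)
  rw [pageMap, norm_sq_discReparam hz]
  set c := Real.sqrt (1 - ‖z‖ ^ 2)
  have h2 : 1 + (1 - c) / (1 + c) = 2 / (1 + c) := by field_simp; ring
  rw [h2]
  congr 2
  · rw [discReparam, smul_smul]
    convert one_smul ℝ z
    field_simp
    rfl
  · field_simp
    ring

lemma discReparam_mem_openDisc {z : ℂ} (hz : z ∈ openDisc) : discReparam z ∈ openDisc := by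
  rw [mem_openDisc] at hz ⊢
  rw [← norm_sq_lt_one_iff, norm_sq_discReparam hz.le]
  have h0 : 0 < Real.sqrt (1 - ‖z‖ ^ 2) := Real.sqrt_pos.2 (by linarith [norm_sq_lt_one_iff.2 hz])
  rw [div_lt_one (by linarith)]
  linarith

lemma mem_pageMap_image_openDisc {q : CTwo} (hq : q ∈ sphereThree) :
    q ∈ pageMap '' openDisc ↔ ∃ c : ℝ, 0 < c ∧ q 1 = c := by
  constructor
  · rintro ⟨w, hw, rfl⟩
    have h1 := norm_sq_lt_one_iff.2 (mem_openDisc.1 hw)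
    exact ⟨(1 - ‖w‖ ^ 2) / (1 + ‖w‖ ^ 2), div_pos (by linarith) (by positivity), by simp [pageMap]⟩
  · rintro ⟨c, hc, hqc⟩
    rw [mem_sphereThree, hqc, Complex.norm_real, Real.norm_eq_abs, sq_abs] at hq
    have h0 : ‖q 0‖ < 1 := norm_sq_lt_one_iff.1 (by nlinarith)
    refine ⟨discReparam (q 0), discReparam_mem_openDisc (mem_openDisc.2 h0), ?_⟩
    rw [pageMap_discReparam h0.le, show 1 - ‖q 0‖ ^ 2 = c ^ 2 by linarith, Real.sqrt_sq hc.le]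
    exact CTwo.ext (by simp) (by simp [hqc])

lemma mem_pageMap_image_sphere {q : CTwo} (hq : q ∈ sphereThree) :
    q ∈ pageMap '' Metric.sphere 0 1 ↔ q 1 = 0 := by
  constructor
  · rintro ⟨w, hw, rfl⟩
    rw [mem_sphere_zero_iff_norm] at hw
    simp [pageMap, hw]
  · intro h
    rw [mem_sphereThree, h] at hq
    have h1 : ‖q 0‖ = 1 := by
      rw [← pow_eq_one_iff_of_nonneg (norm_nonneg _) two_ne_zero]
      simpa using hq
    refine ⟨q 0, by simpa using h1, CTwo.ext ?_ ?_⟩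
    · simp [pageMap, h1]; norm_num
    · simp [pageMap, h1, h]

/-- The page lies in the hyperplane `Im z₂ = 0`; the Reeb field will be seen to leave it. -/
lemma fderivWithin_pageMap_im {z : ℂ} (hz : z ∈ closedDisc) (u : ℂ) :
    (fderivWithin ℝ pageMap closedDisc z u 1).im = 0 := by
  rw [fderivWithin_pageMap hz]
  have h1 : HasFDerivAt (fun w => ((pageMap w) 1).im)
      ((Complex.imCLM.comp (coordCLM 1)).comp (fderiv ℝ pageMap z)) z :=
    (Complex.imCLM.comp (coordCLM 1)).hasFDerivAt.comp z
      (pageMap_contDiff.differentiable (by simp) z).hasFDerivAt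
  have h2 : (fun w => ((pageMap w) 1).im) = fun _ => (0 : ℝ) := by
    funext w
    simp [pageMap, -Complex.ofReal_div]
  rw [h2] at h1
  have h3 := h1.unique (hasFDerivAt_const (0 : ℝ) z)
  have h4 := congrArg (fun L : ℂ →L[ℝ] ℝ => L u) h3
  simpa using h4

lemma discReparam_isRadialReparametrization : IsRadialReparametrization discReparam where
  radial := by
    refine ⟨fun r => r / (1 + Real.sqrt (1 - r ^ 2)), ?_, ?_, by simp, by simp, ?_⟩
    · refine Continuous.continuousOn (Continuous.div continuous_id (by fun_prop) fun r => ?_)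
      have := Real.sqrt_nonneg (1 - r ^ 2)
      positivity
    · intro a ha b hb hab
      have h1 : Real.sqrt (1 - b ^ 2) ≤ Real.sqrt (1 - a ^ 2) :=
        Real.sqrt_le_sqrt (by nlinarith [ha.1])
      have h2 := Real.sqrt_nonneg (1 - b ^ 2)
      exact div_lt_div₀ hab (by linarith) (ha.1.trans hab.le) (by linarith)
    · intro r hr u hu
      rw [discReparam, norm_smul, hu, mul_one, Real.norm_eq_abs, sq_abs, smul_smul]
      congr 1
      ring
  smooth := by
    intro z hz
    have hz' := norm_sq_lt_one_iff.2 (mem_openDisc.1 hz)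
    have h0 := Real.sqrt_nonneg (1 - ‖z‖ ^ 2)
    have h1 : ContDiffAt ℝ ∞ (fun w : ℂ => Real.sqrt (1 - ‖w‖ ^ 2)) z :=
      (contDiffAt_const.sub (contDiff_id.norm_sq ℝ).contDiffAt).sqrt (by simp; linarith)
    exact ((contDiffAt_const.div (contDiffAt_const.add h1) (by positivity)).smul
      contDiffAt_id).contDiffWithinAt
  immersion := by
    intro z hz
    have hz' := norm_sq_lt_one_iff.2 (mem_openDisc.1 hz)
    have h0 := Real.sqrt_nonneg (1 - ‖z‖ ^ 2)
    have h1 : ContDiffAt ℝ ∞ (fun w : ℂ => Real.sqrt (1 - ‖w‖ ^ 2)) z :=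
      (contDiffAt_const.sub (contDiff_id.norm_sq ℝ).contDiffAt).sqrt (by simp; linarith)
    have h2 : ContDiffAt ℝ ∞ discReparam z :=
      (contDiffAt_const.div (contDiffAt_const.add h1) (by positivity)).smul contDiffAt_id
    -- The left inverse is `w ↦ 2w / (1 + ‖w‖²)`, the first coordinate of `pageMap`.
    refine fderiv_injective_of_leftInverse (h2.differentiableAt (by simp))
      (contDiff_two_div.differentiable (by simp) _) ?_
    filter_upwards [Metric.isOpen_ball.mem_nhds hz] with w hw
    have h3 := pageMap_discReparam (mem_openDisc.1 hw).le
    have h4 := congrArg (fun q : CTwo => q 0) h3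
    simpa [pageMap] using h4

/-! ### Construction of the Reeb flow -/

lemma strictMono_and_surjective_of_deriv_ge {f f' : ℝ → ℝ} {c : ℝ} (hc : 0 < c)
    (hf : ∀ t, HasDerivAt f (f' t) t) (hle : ∀ t, c ≤ f' t) :
    StrictMono f ∧ Function.Surjective f := by
  have hcont : Continuous f := continuous_iff_continuousAt.2 fun t => (hf t).continuousAt
  refine ⟨strictMono_of_deriv_pos fun t => by rw [(hf t).deriv]; exact hc.trans_le (hle t), ?_⟩
  -- Monotonicity of `f t - c * t` compares `f` with the line `f 0 + c * t`, which forces both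
  -- limits at infinity.
  have hg : ∀ t, HasDerivAt (fun t => f t - c * t) (f' t - c) t := fun t =>
    ((hf t).sub ((hasDerivAt_id t).const_mul c)).congr_deriv (by simp)
  have hmono : Monotone fun t => f t - c * t :=
    monotone_of_deriv_nonneg (fun t => (hg t).differentiableAt)
      fun t => by rw [(hg t).deriv]; linarith [hle t]
  refine hcont.surjective ?_ ?_
  · refine Filter.tendsto_atTop_mono' _ (f₁ := fun t => f 0 + c * t) ?_
      (Filter.tendsto_atTop_add_const_left _ _ (Filter.tendsto_id.const_mul_atTop hc))
    filter_upwards [Filter.eventually_ge_atTop 0] with t ht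
    have h := hmono ht
    simp only [mul_zero, sub_zero] at h
    linarith
  · refine Filter.tendsto_atBot_mono' _ (f₁ := fun t => f 0 + c * t) ?_
      (Filter.tendsto_atBot_add_const_left _ _ (Filter.tendsto_id.const_mul_atBot hc))
    filter_upwards [Filter.eventually_le_atBot 0] with t ht
    have h := hmono ht
    simp only [mul_zero, sub_zero] at h
    linarith

section Smoothness

variable {b : CTwo → ℝ} {p : CTwo}

lemma contDiffAt_fderiv_apply {g : CTwo → CTwo} (hb : ContDiffAt ℝ ∞ b p)
    (hg : ContDiffAt ℝ ∞ g p) : ContDiffAt ℝ ∞ (fun q => fderiv ℝ b q (g q)) p :=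
  (hb.fderiv_right (m := ∞) (by simp)).clm_apply hg

lemma contactDensity_contDiffAt (hb : ContDiffAt ℝ ∞ b p) :
    ContDiffAt ℝ ∞ (contactDensity b) p := by
  have h0 : ContDiffAt ℝ ∞ (fun q : CTwo => q 0) p := (coordCLM 0).contDiff.contDiffAt
  have h1 : ContDiffAt ℝ ∞ (fun q : CTwo => q 1) p := (coordCLM 1).contDiff.contDiffAt
  exact ((contDiffAt_const.mul hb).add ((h0.norm_sq ℝ).mul (contDiffAt_fderiv_apply hb
    ((inclCLM 1).contDiff.contDiffAt.comp p h1)))).sub ((h1.norm_sq ℝ).mul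
      (contDiffAt_fderiv_apply hb ((inclCLM 0).contDiff.contDiffAt.comp p h0)))

lemma kernelField_contDiffAt (hb : ContDiffAt ℝ ∞ b p) : ContDiffAt ℝ ∞ (kernelField b) p := by
  have h0 : ContDiffAt ℝ ∞ (fun q : CTwo => q 0) p := (coordCLM 0).contDiff.contDiffAt
  have h1 : ContDiffAt ℝ ∞ (fun q : CTwo => q 1) p := (coordCLM 1).contDiff.contDiffAt
  have hof : ∀ {g : CTwo → ℝ}, ContDiffAt ℝ ∞ g p → ContDiffAt ℝ ∞ (fun q => (g q : ℂ)) p :=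
    fun hg => Complex.ofRealCLM.contDiff.contDiffAt.comp p hg
  have e1 := (contDiffAt_const (c := (2 : ℝ)).mul hb).add (contDiffAt_fderiv_apply hb
    ((inclCLM 1).contDiff.contDiffAt.comp p h1))
  have e2 := hof (contDiffAt_fderiv_apply hb (contDiffAt_const (c := inclCLM 0 1)))
  have e3 := hof (contDiffAt_fderiv_apply hb (contDiffAt_const (c := inclCLM 0 Complex.I)))
  have e4 := hof (contDiffAt_fderiv_apply hb ((inclCLM 0).contDiff.contDiffAt.comp p
    ((contDiffAt_const (c := Complex.I)).mul h0)))
  have f0 := (contDiffAt_const (c := Complex.I)).mul (((hof e1).mul h0).sub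
    ((hof (h1.norm_sq ℝ)).mul (e2.add (e3.mul (contDiffAt_const (c := Complex.I))))))
  have f1 := ((contDiffAt_const (c := 2 * Complex.I)).sub e4).mul h1
  exact ((inclCLM 0).contDiff.contDiffAt.comp p f0).add ((inclCLM 1).contDiff.contDiffAt.comp p f1)

lemma isTangentToSphere_smul {p v : CTwo} (c : ℝ) (hv : IsTangentToSphere p v) :
    IsTangentToSphere p (c • v) := by
  rw [isTangentToSphere_iff] at hv ⊢
  simp
  linear_combination c * hv

end Smoothness

lemma isCompact_sphereThree : IsCompact sphereThree := isCompact_sphere 0 1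

/-- The Reeb vector field of `bForm b`, extended to a Lipschitz field, and its flow. -/
theorem exists_reeb_flow {b : CTwo → ℝ} {V : Set CTwo} (hV : IsOpen V) (hSV : sphereThree ⊆ V)
    (hb : ∀ p ∈ V, ContDiffAt ℝ ∞ b p) (hD : ∀ p ∈ sphereThree, contactDensity b p ≠ 0) :
    ∃ (R : CTwo → CTwo) (φ : ℝ → CTwo → CTwo) (L : NNReal), LipschitzWith L R ∧
      (∀ p ∈ sphereThree, R p = (contactDensity b p)⁻¹ • kernelField b p) ∧
      IsFlowOnSphere R φ := by
  have hDc : ContinuousOn (contactDensity b) V := fun p hp =>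
    (contactDensity_contDiffAt (hb p hp)).continuousAt.continuousWithinAt
  have hW : IsOpen (V ∩ contactDensity b ⁻¹' {0}ᶜ) :=
    hDc.isOpen_inter_preimage hV isOpen_compl_singleton
  obtain ⟨χ, L, M, hχ, hL, hM⟩ := exists_lipschitz_cutoff isCompact_sphereThree hW
    (fun p hp => ⟨hSV hp, hD p hp⟩)
    (f := fun p => (contactDensity b p)⁻¹ • kernelField b p) (fun p hp =>
      (((contactDensity_contDiffAt (hb p hp.1)).inv hp.2).smul
        (kernelField_contDiffAt (hb p hp.1))).contDiffWithinAt)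
  obtain ⟨φ, hφ0, hφ⟩ := exists_global_flow hL hM
  refine ⟨_, φ, L, hL, fun p hp => by rw [hχ p hp, one_smul], fun p _ => hφ0 p, ?_,
    fun t p _ => hφ t p⟩
  intro t p hp
  have hcoord : ∀ j t, HasDerivAt (fun τ => φ τ p j) (((χ (φ t p)) •
      (contactDensity b (φ t p))⁻¹ • kernelField b (φ t p)) j) t := fun j t =>
    (coordCLM j).hasFDerivAt.comp_hasDerivAt t (hφ t p)
  have hconst : ∀ t, HasDerivAt (fun τ => ‖φ τ p 0‖ ^ 2 + ‖φ τ p 1‖ ^ 2) 0 t := by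
    intro t
    refine ((hcoord 0 t).norm_sq.add (hcoord 1 t).norm_sq).congr_deriv ?_
    have h := isTangentToSphere_iff.1 (isTangentToSphere_smul (χ (φ t p))
      (isTangentToSphere_smul (contactDensity b (φ t p))⁻¹
        (isTangentToSphere_kernelField b (φ t p))))
    simp only [Complex.inner, Complex.mul_re, Complex.conj_re, Complex.conj_im]
    linarith
  have h := is_const_of_deriv_eq_zero (fun t => (hconst t).differentiableAt)
    (fun t => (hconst t).deriv) t 0
  rw [mem_sphereThree] at hp ⊢
  rw [h, hφ0, hp]

lemma isReebVectorField_bForm {b : CTwo → ℝ} (hb : ∀ p ∈ sphereThree, ContDiffAt ℝ ∞ b p)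
    (hD : ∀ p ∈ sphereThree, contactDensity b p ≠ 0) {R : CTwo → CTwo}
    (hR : ∀ p ∈ sphereThree, R p = (contactDensity b p)⁻¹ • kernelField b p) :
    IsReebVectorField (bForm b) R where
  tangent := fun p hp => by
    rw [hR p hp]
    exact isTangentToSphere_smul _ (isTangentToSphere_kernelField b p)
  normalized := fun p hp => by
    rw [hR p hp, map_smul, bForm_kernelField b hp, smul_eq_mul, inv_mul_cancel₀ (hD p hp)]
  kernel := fun p hp v hv => by
    have h := dOneForm_bForm_kernelField (hb p hp) hv
    rw [dOneForm_bForm (hb p hp)] at h ⊢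
    rw [hR p hp]
    simp only [map_smul, smul_apply, smul_eq_mul]
    linear_combination (contactDensity b p)⁻¹ * h

lemma isContactFormOnSphere_bForm {b : CTwo → ℝ} (hb : ∀ p ∈ sphereThree, ContDiffAt ℝ ∞ b p)
    (hD : ∀ p ∈ sphereThree, contactDensity b p ≠ 0) : IsContactFormOnSphere (bForm b) where
  smooth := fun p hp => bForm_contDiffAt (hb p hp)
  contact := fun p hp _ _ _ hu hv hw h => bForm_contact hp (hb p hp) (hD p hp) hu hv hw h

/-! ### Global surface of section and first return -/

section Flow

variable {b : CTwo → ℝ} {R : CTwo → CTwo} {φ : ℝ → CTwo → CTwo} {L : NNReal}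

/-- Along a Reeb orbit the argument of the second coordinate increases with speed `2 / D`. -/
lemma exists_angle (hb : ∀ p ∈ sphereThree, ContDiffAt ℝ ∞ b p)
    (hD : ∀ p ∈ sphereThree, contactDensity b p ≠ 0)
    (hR : ∀ p ∈ sphereThree, R p = (contactDensity b p)⁻¹ • kernelField b p)
    (hφ : IsFlowOnSphere R φ) {p : CTwo} (hp : p ∈ sphereThree) (h1 : p 1 ≠ 0) :
    ∃ Θ : ℝ → ℝ, (∀ t, HasDerivAt Θ (2 / contactDensity b (φ t p)) t) ∧
      ∀ t, ∃ c : ℝ, 0 < c ∧ φ t p 1 = c * Complex.exp (Θ t * Complex.I) := by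
  have hφc : Continuous fun t => φ t p :=
    continuous_iff_continuousAt.2 fun t => (hφ.deriv t p hp).continuousAt
  have hcomp : ∀ {g : CTwo → ℝ}, (∀ q ∈ sphereThree, ContDiffAt ℝ ∞ g q) →
      Continuous fun t => g (φ t p) := fun hg => continuous_iff_continuousAt.2 fun t =>
    ContinuousAt.comp (f := fun t => φ t p) (hg _ (hφ.mapsTo t p hp)).continuousAt
      hφc.continuousAt
  have hDc := hcomp fun q hq => contactDensity_contDiffAt (hb q hq)
  have hEc := hcomp (g := fun q => fderiv ℝ b q (inclCLM 0 (Complex.I * q 0))) fun q hq =>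
    contDiffAt_fderiv_apply (hb q hq) ((inclCLM 0).contDiff.contDiffAt.comp q
      (contDiffAt_const.mul (coordCLM 0).contDiff.contDiffAt))
  have hne : ∀ t, contactDensity b (φ t p) ≠ 0 := fun t => hD _ (hφ.mapsTo t p hp)
  set d : ℝ → ℝ := fun t => contactDensity b (φ t p) with hd
  set ℓ : ℝ → ℝ := fun t => fderiv ℝ b (φ t p) (inclCLM 0 (Complex.I * φ t p 0)) with hℓ
  let Θ : ℝ → ℝ := fun t => (p 1).arg + ∫ s in (0 : ℝ)..t, 2 / d s
  let A : ℝ → ℝ := fun t => ∫ s in (0 : ℝ)..t, ℓ s / d s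
  have hΘ : ∀ t, HasDerivAt Θ (2 / d t) t := fun t =>
    ((continuous_const.div hDc hne).integral_hasStrictDerivAt 0 t).hasDerivAt.const_add _
  have hA : ∀ t, HasDerivAt A (ℓ t / d t) t := fun t =>
    ((hEc.div hDc hne).integral_hasStrictDerivAt 0 t).hasDerivAt
  -- The second coordinate solves a scalar linear equation, so an integrating factor gives its
  -- modulus and a continuous angle explicitly.
  have hz : ∀ t, HasDerivAt (fun t => φ t p 1)
      ((2 * Complex.I - ℓ t) / d t * φ t p 1) t := fun t => by
    refine ((coordCLM 1).hasFDerivAt.comp_hasDerivAt t (hφ.deriv t p hp)).congr_deriv ?_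
    rw [hR _ (hφ.mapsTo t p hp)]
    simp [kernelField, hd, hℓ]
    ring
  have hE : ∀ t, HasDerivAt (fun t => Complex.exp (A t - Θ t * Complex.I))
      (Complex.exp (A t - Θ t * Complex.I) * ((ℓ t / d t : ℝ) - (2 / d t : ℝ) * Complex.I)) t :=
    fun t => ((hA t).ofReal_comp.sub ((hΘ t).ofReal_comp.mul_const Complex.I)).cexp
  have hconst : ∀ t, HasDerivAt (fun t => φ t p 1 * Complex.exp (A t - Θ t * Complex.I)) 0 t := by
    intro t
    refine ((hz t).mul (hE t)).congr_deriv ?_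
    push_cast
    ring
  refine ⟨Θ, hΘ, fun t => ⟨‖p 1‖ * Real.exp (-A t), by positivity, ?_⟩⟩
  have h := is_const_of_deriv_eq_zero (fun t => (hconst t).differentiableAt)
    (fun t => (hconst t).deriv) t 0
  have hA0 : A 0 = 0 := by simp [A]
  have hΘ0 : Θ 0 = (p 1).arg := by simp [Θ]
  rw [hA0, hΘ0, hφ.initial p hp] at h
  have h2 : p 1 * Complex.exp ((0 : ℝ) - (p 1).arg * Complex.I) = ‖p 1‖ := by
    conv_lhs => rw [← Complex.norm_mul_exp_arg_mul_I (p 1)]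
    rw [mul_assoc, ← Complex.exp_add]
    simp
  rw [h2] at h
  have h3 : Complex.exp (A t - Θ t * Complex.I) * (Complex.exp (-A t) *
      Complex.exp (Θ t * Complex.I)) = 1 := by
    rw [← Complex.exp_add, ← Complex.exp_add]
    simp
  push_cast
  rw [mul_assoc, ← h, mul_assoc, h3, mul_one]

/-- By compactness `contactDensity b` is at most some `M`, so the angle of `z₂` advances at speed at
least `2 / M` and takes every value in `2πℤ`; at these times `z₂` is positive real. -/
lemma exists_hit_forward_backward (hb : ∀ p ∈ sphereThree, ContDiffAt ℝ ∞ b p)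
    (hD : ∀ p ∈ sphereThree, 2 ≤ contactDensity b p)
    (hR : ∀ p ∈ sphereThree, R p = (contactDensity b p)⁻¹ • kernelField b p)
    (hφ : IsFlowOnSphere R φ) {p : CTwo} (hp : p ∈ sphereThree) (h1 : p 1 ≠ 0) :
    (∃ t : ℝ, 0 < t ∧ φ t p ∈ pageMap '' openDisc) ∧
      ∃ t : ℝ, t < 0 ∧ φ t p ∈ pageMap '' openDisc := by
  have hD' : ∀ p ∈ sphereThree, contactDensity b p ≠ 0 := fun p hp => by linarith [hD p hp]
  obtain ⟨Θ, hΘ, hhit⟩ := exists_angle hb hD' hR hφ hp h1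
  obtain ⟨M, hM⟩ := isCompact_sphereThree.exists_bound_of_continuousOn (f := contactDensity b)
    fun q hq => (contactDensity_contDiffAt (hb q hq)).continuousAt.continuousWithinAt
  have hMpos : 0 < M := by linarith [hD p hp, (abs_le.1 (hM p hp)).2]
  obtain ⟨hmono, hsurj⟩ := strictMono_and_surjective_of_deriv_ge (div_pos two_pos hMpos) hΘ
    fun t => div_le_div_of_nonneg_left zero_le_two
      (by linarith [hD _ (hφ.mapsTo t p hp)]) (abs_le.1 (hM _ (hφ.mapsTo t p hp))).2
  have key : ∀ n : ℤ, ∃ t, Θ t = n * (2 * Real.pi) ∧ φ t p ∈ pageMap '' openDisc := by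
    intro n
    obtain ⟨t, ht⟩ := hsurj (n * (2 * Real.pi))
    obtain ⟨c, hc, hct⟩ := hhit t
    refine ⟨t, ht, (mem_pageMap_image_openDisc (hφ.mapsTo t p hp)).2 ⟨c, hc, ?_⟩⟩
    rw [hct, ht, show ((n * (2 * Real.pi) : ℝ) : ℂ) * Complex.I = n * (2 * Real.pi * Complex.I) by
      push_cast; ring, Complex.exp_int_mul_two_pi_mul_I, mul_one]
  have h2pi : 0 < 2 * Real.pi := Real.two_pi_pos
  constructor
  · obtain ⟨n, hn⟩ := exists_int_gt (Θ 0 / (2 * Real.pi))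
    obtain ⟨t, ht, hmem⟩ := key n
    exact ⟨t, hmono.lt_iff_lt.1 (by rw [ht]; exact (div_lt_iff₀ h2pi).1 hn), hmem⟩
  · obtain ⟨n, hn⟩ := exists_int_lt (Θ 0 / (2 * Real.pi))
    obtain ⟨t, ht, hmem⟩ := key n
    exact ⟨t, hmono.lt_iff_lt.1 (by rw [ht]; exact (lt_div_iff₀ h2pi).1 hn), hmem⟩

/-- The binding of the open book is a periodic Reeb orbit. -/
lemma flow_binding (hL : LipschitzWith L R)
    (hD : ∀ p ∈ sphereThree, contactDensity b p ≠ 0)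
    (hR : ∀ p ∈ sphereThree, R p = (contactDensity b p)⁻¹ • kernelField b p)
    (hφ : IsFlowOnSphere R φ) (t : ℝ) :
    φ t (pairC 1 0) = pairC (Complex.exp (t * Complex.I)) 0 := by
  have hmem : ∀ t : ℝ, pairC (Complex.exp (t * Complex.I)) 0 ∈ sphereThree := fun t => by
    rw [mem_sphereThree]
    simp [Complex.norm_exp_ofReal_mul_I]
  have h1 : pairC 1 0 ∈ sphereThree := by simpa using hmem 0
  have hRb : ∀ t : ℝ, R (pairC (Complex.exp (t * Complex.I)) 0) =
      pairC (Complex.exp (t * Complex.I) * Complex.I) 0 := by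
    intro t
    have hDt := hD _ (hmem t)
    rw [hR _ (hmem t)]
    set q := pairC (Complex.exp (t * Complex.I)) 0 with hq
    -- Where `z₂ = 0` all terms with derivatives of `b` vanish, so there the Reeb field is `(i z₁,
    -- 0)` whatever `b` is.
    have hdens : contactDensity b q = 2 * b q := by simp [contactDensity, hq]
    have hb0 : (b q : ℂ) ≠ 0 := by
      rw [hdens] at hDt
      exact_mod_cast (mul_ne_zero_iff.1 hDt).2
    rw [hdens]
    apply CTwo.ext
    · have h0 : q 0 = Complex.exp (t * Complex.I) := by simp [hq]
      have h1 : q 1 = 0 := by simp [hq]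
      simp [kernelField, h0, h1]
      field_simp
    · simp [kernelField, hq]
  have hderiv : ∀ t : ℝ, HasDerivAt (fun t : ℝ => pairC (Complex.exp (t * Complex.I)) 0)
      (R (pairC (Complex.exp (t * Complex.I)) 0)) t := by
    intro t
    rw [hRb]
    refine HasDerivAt.pairC ?_ (hasDerivAt_const t 0)
    simpa using ((hasDerivAt_id t).ofReal_comp.mul_const Complex.I).cexp
  have h := ODE_solution_unique_univ (v := fun _ => R) (s := fun _ => Set.univ) (K := L) (t₀ := 0)
    (f := fun t => φ t (pairC 1 0)) (g := fun t : ℝ => pairC (Complex.exp (t * Complex.I)) 0)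
    (fun _ => hL.lipschitzOnWith) (fun t => ⟨hφ.deriv t _ h1, trivial⟩)
    (fun t => ⟨hderiv t, trivial⟩) (by simp [hφ.initial _ h1])
  exact congrFun h t

lemma isDiscGlobalSurfaceOfSection_pageMap (hb : ∀ p ∈ sphereThree, ContDiffAt ℝ ∞ b p)
    (hL : LipschitzWith L R) (hD : ∀ p ∈ sphereThree, 2 ≤ contactDensity b p)
    (hR : ∀ p ∈ sphereThree, R p = (contactDensity b p)⁻¹ • kernelField b p)
    (hφ : IsFlowOnSphere R φ) : IsDiscGlobalSurfaceOfSection R φ pageMap := by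
  have hD' : ∀ p ∈ sphereThree, contactDensity b p ≠ 0 := fun p hp => by linarith [hD p hp]
  have hbind := flow_binding hL hD' hR hφ
  have h1 : pairC 1 0 ∈ sphereThree := by rw [mem_sphereThree]; simp
  refine ⟨pageMap_isSmoothDiscEmbedding, ⟨pairC 1 0, h1, 2 * Real.pi, Real.two_pi_pos, ?_, ?_⟩,
    ?_, ?_, ?_⟩
  · rw [hbind]
    push_cast
    rw [Complex.exp_two_pi_mul_I]
  · apply Set.Subset.antisymm
    · rintro _ ⟨w, hw, rfl⟩
      have hw1 : ‖w‖ = 1 := by simpa using hw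
      have h2 := (mem_pageMap_image_sphere (pageMap_mem w)).1 ⟨w, hw, rfl⟩
      refine ⟨w.arg, ?_⟩
      dsimp only
      rw [hbind]
      have h3 := Complex.norm_mul_exp_arg_mul_I w
      rw [hw1, Complex.ofReal_one, one_mul] at h3
      refine CTwo.ext ?_ (by simp [h2])
      rw [pairC_zero, h3, pageMap, hw1]
      norm_num
    · rintro _ ⟨t, rfl⟩
      rw [mem_pageMap_image_sphere (hφ.mapsTo t _ h1)]
      dsimp only
      rw [hbind, pairC_one]
  · rintro z hz ⟨u, hu⟩
    have hzc : z ∈ closedDisc := Metric.ball_subset_closedBall hz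
    have him := fderivWithin_pageMap_im hzc u
    rw [hu, hR _ (pageMap_mem z)] at him
    obtain ⟨c, hc, hzc⟩ := (mem_pageMap_image_openDisc (pageMap_mem z)).1 ⟨z, hz, rfl⟩
    have hne := hD' _ (pageMap_mem z)
    -- The second coordinate of the kernel field at `z₂ = c` has imaginary part `2c ≠ 0`.
    simp [kernelField, hzc, hc.ne', hne] at him
  · intro p hp
    exact (exists_hit_forward_backward hb hD hR hφ hp.1
      fun h => hp.2 ((mem_pageMap_image_sphere hp.1).2 h)).1
  · intro p hp
    exact (exists_hit_forward_backward hb hD hR hφ hp.1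
      fun h => hp.2 ((mem_pageMap_image_sphere hp.1).2 h)).2

/-- A curve on the sphere that is a positive time change of a Reeb orbit with angular speed `1`
in the second coordinate realizes the first return map. -/
lemma isFirstReturn_of_suspension (hb : ∀ p ∈ sphereThree, ContDiffAt ℝ ∞ b p)
    (hL : LipschitzWith L R) (hD : ∀ p ∈ sphereThree, 2 ≤ contactDensity b p)
    (hR : ∀ p ∈ sphereThree, R p = (contactDensity b p)⁻¹ • kernelField b p)
    (hφ : IsFlowOnSphere R φ) {Γ : ℝ → CTwo} (hΓ : ∀ s, Γ s ∈ sphereThree)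
    (hΓ' : ∀ s, HasDerivAt Γ ((1 / 2 : ℝ) • kernelField b (Γ s)) s)
    (hpos : ∀ s, ∃ c : ℝ, 0 < c ∧ Γ s 1 = c * Complex.exp (s * Complex.I)) :
    IsFirstReturn φ (pageMap '' openDisc) (Γ 0) (Γ (2 * Real.pi)) := by
  have hΓc : Continuous Γ := continuous_iff_continuousAt.2 fun t => (hΓ' t).continuousAt
  have hDc : Continuous fun s => contactDensity b (Γ s) := continuous_iff_continuousAt.2 fun t =>
    (contactDensity_contDiffAt (hb _ (hΓ t))).continuousAt.comp hΓc.continuousAt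
  obtain ⟨M, hM⟩ := isCompact_sphereThree.exists_bound_of_continuousOn (f := contactDensity b)
    fun q hq => (contactDensity_contDiffAt (hb q hq)).continuousAt.continuousWithinAt
  -- The Reeb field is `kernelField / D` and `Γ` has velocity `kernelField / 2`, so Reeb time
  -- elapses at rate `D / 2 ≥ 1` along `Γ`.
  let τ : ℝ → ℝ := fun s => ∫ σ in (0 : ℝ)..s, contactDensity b (Γ σ) / 2
  have hτ : ∀ s, HasDerivAt τ (contactDensity b (Γ s) / 2) s := fun s =>
    ((hDc.div_const 2).integral_hasStrictDerivAt 0 s).hasDerivAt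
  have hτ0 : τ 0 = 0 := by simp [τ]
  obtain ⟨hmono, hsurj⟩ := strictMono_and_surjective_of_deriv_ge one_pos hτ
    fun s => by linarith [hD _ (hΓ s)]
  -- The density is evaluated along the fixed curve `Γ` and only `R` depends on `x`. This gives a
  -- time-dependent field with a uniform Lipschitz constant, and both curves solve its equation.
  have hlip : ∀ s, LipschitzWith (M.toNNReal * L)
      (fun x => (contactDensity b (Γ s) / 2) • R x) := by
    intro s
    refine LipschitzWith.of_dist_le_mul fun x y => ?_
    rw [dist_smul₀, NNReal.coe_mul, mul_assoc]
    have h1 := hM _ (hΓ s)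
    have h2 : ‖contactDensity b (Γ s) / 2‖ ≤ M.toNNReal := by
      refine le_trans ?_ (Real.le_coe_toNNReal M)
      rw [norm_div, Real.norm_two]
      linarith [norm_nonneg (contactDensity b (Γ s))]
    exact mul_le_mul h2 (hL.dist_le_mul x y) dist_nonneg (NNReal.coe_nonneg _)
  have heq := ODE_solution_unique_univ (s := fun _ => Set.univ) (t₀ := 0)
    (f := fun s => φ (τ s) (Γ 0)) (g := Γ) (fun s => (hlip s).lipschitzOnWith)
    (fun s => ⟨(hφ.deriv (τ s) _ (hΓ 0)).scomp s (hτ s), trivial⟩)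
    (fun s => ⟨(hΓ' s).congr_deriv (by
      have hne : contactDensity b (Γ s) ≠ 0 := by linarith [hD _ (hΓ s)]
      rw [hR _ (hΓ s), smul_smul]
      congr 1
      field_simp), trivial⟩)
    (by simp [hτ0, hφ.initial _ (hΓ 0)])
  have hflow : ∀ s, φ (τ s) (Γ 0) = Γ s := fun s => congrFun heq s
  refine ⟨τ (2 * Real.pi), ⟨⟨?_, ?_⟩, ?_⟩, hflow _⟩
  · rw [← hτ0]
    exact hmono Real.two_pi_pos
  · rw [hflow, mem_pageMap_image_openDisc (hΓ _)]
    obtain ⟨c, hc, hcs⟩ := hpos (2 * Real.pi)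
    refine ⟨c, hc, ?_⟩
    rw [hcs]
    push_cast
    rw [Complex.exp_two_pi_mul_I, mul_one]
  · rintro t ⟨ht0, ht⟩
    obtain ⟨s, rfl⟩ := hsurj t
    rw [← hτ0] at ht0
    have hs0 := hmono.lt_iff_lt.1 ht0
    rw [hflow, mem_pageMap_image_openDisc (hΓ s)] at ht
    obtain ⟨c, hc, hcs⟩ := hpos s
    obtain ⟨c', hc', hcs'⟩ := ht
    rw [hcs] at hcs'
    have hcc : c = c' := by
      have h := congrArg norm hcs'
      rwa [norm_mul_exp_ofReal_mul_I, Complex.norm_of_nonneg hc.le,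
        Complex.norm_of_nonneg hc'.le] at h
    -- The page is met only at `s ∈ 2πℤ`, and the least positive such value is `2π`.
    have h1 : Complex.exp (s * Complex.I) = 1 := by
      apply mul_left_cancel₀ (Complex.ofReal_ne_zero.2 hc.ne')
      rw [hcs', hcc, mul_one]
    obtain ⟨n, hn⟩ := Complex.exp_eq_one_iff.1 h1
    have hsn : s = n * (2 * Real.pi) := by
      have h := congrArg Complex.im hn
      simpa using h
    apply hmono.monotone
    have hn1 : (1 : ℝ) ≤ n := by
      have : 0 < n := by
        by_contra hneg
        have : (n : ℝ) ≤ 0 := by exact_mod_cast not_lt.1 hneg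
        nlinarith [Real.two_pi_pos]
      exact_mod_cast this
    rw [hsn]
    nlinarith [Real.two_pi_pos]

end Flow

/-! ### The isotopy and its suspension -/

section Isotopy

variable {H : ℝ → ℂ → ℝ} {F : ℝ → ℝ} {K : ℝ → ℂ → ℝ} {r : ℝ} {X Ψ : ℝ → ℂ → ℂ}

/-- On the collar the Hamiltonian vector field is tangent to the circles about the origin. -/
lemma IsCollarSplitting.vectorField_tangent (h : IsCollarSplitting H F K r)
    (hsmooth : ContDiffOn ℝ ∞ (fun p : ℝ × ℂ => H p.1 p.2) (Set.univ ×ˢ closedDisc))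
    (hX : IsHamiltonianVectorField H X) (s : ℝ) {w : ℂ} (hr : r ≤ ‖w‖) (hw : w ∈ closedDisc) :
    w.re * (X s w).re + w.im * (X s w).im = 0 := by
  have hw1 := mem_closedDisc.1 hw
  have hd : DifferentiableWithinAt ℝ (H s) closedDisc w := by
    have h1 : ContDiffOn ℝ ∞ (H s) closedDisc :=
      hsmooth.comp (contDiff_const.prodMk contDiff_id).contDiffOn fun z hz => ⟨trivial, hz⟩
    exact h1.differentiableOn (by simp) w hw
  have hn : ∀ t : ℝ, ‖w * Complex.exp (t * Complex.I)‖ = ‖w‖ := norm_mul_exp_ofReal_mul_I w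
  have hc : HasDerivAt (fun t : ℝ => w * Complex.exp (t * Complex.I)) (w * Complex.I) 0 := by
    have h1 := (((hasDerivAt_id (0 : ℝ)).ofReal_comp.mul_const Complex.I).cexp).const_mul w
    simpa using h1
  -- The rotation curve stays in the disc even when `‖w‖ = 1`, so the one-sided differential can be
  -- evaluated along it; `H s` is constant on the circle.
  have h1 : HasDerivAt (fun t : ℝ => H s (w * Complex.exp (t * Complex.I)))
      (fderivWithin ℝ (H s) closedDisc w (w * Complex.I)) 0 :=
    HasFDerivWithinAt.comp_hasDerivAt_of_eq (l := H s) (t := closedDisc)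
      (f := fun t : ℝ => w * Complex.exp (t * Complex.I)) 0 hd.hasFDerivWithinAt hc
      (Filter.Eventually.of_forall fun t => mem_closedDisc.2 (by rw [hn]; exact hw1)) (by simp)
  have h2 : (fun t : ℝ => H s (w * Complex.exp (t * Complex.I))) = fun _ => F (‖w‖ ^ 2) := by
    funext t
    rw [h.eq s _ (by rw [hn]; exact hw1), h.support s _ (by rw [hn]; exact hr), hn, add_zero]
  rw [h2] at h1
  have h3 := h1.unique (hasDerivAt_const 0 (F (‖w‖ ^ 2)))
  rw [← hX s w hw, discAreaForm] at h3
  simp at h3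
  linarith

/-- The isotopy preserves the interior of the disc. -/
lemma IsCollarSplitting.isotopy_norm_lt_one (h : IsCollarSplitting H F K r)
    (hsmooth : ContDiffOn ℝ ∞ (fun p : ℝ × ℂ => H p.1 p.2) (Set.univ ×ˢ closedDisc))
    (hX : IsHamiltonianVectorField H X) (hΨ : IsIsotopyGeneratedBy X Ψ) {z : ℂ}
    (hz : z ∈ openDisc) (s : ℝ) : ‖Ψ s z‖ < 1 := by
  have hzc : z ∈ closedDisc := Metric.ball_subset_closedBall hz
  have hle : ∀ s, ‖Ψ s z‖ ≤ 1 := fun s => mem_closedDisc.1 (hΨ.mapsTo s z hzc)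
  have hcont : Continuous fun s => ‖Ψ s z‖ :=
    (continuous_iff_continuousAt.2 fun s => (hΨ.deriv s z hzc).continuousAt).norm
  -- The set of times spent on the boundary circle is clopen: near such a time the orbit is in the
  -- collar, where its norm is constant. As `ℝ` is connected and `0` is not in the set, it is empty.
  have hclosed : IsClosed {s | ‖Ψ s z‖ = 1} := isClosed_eq hcont continuous_const
  have hopen : IsOpen {s | ‖Ψ s z‖ = 1} := by
    rw [Metric.isOpen_iff]
    intro s hs
    have hev : ∀ᶠ σ in nhds s, r < ‖Ψ σ z‖ :=
      hcont.continuousAt.eventually (lt_mem_nhds (h.lt_one.trans_eq hs.symm))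
    obtain ⟨ε, hε, hball⟩ := Metric.eventually_nhds_iff_ball.1 hev
    refine ⟨ε, hε, fun σ hσ => ?_⟩
    have hderiv : ∀ t ∈ Metric.ball s ε, HasDerivAt (fun σ => ‖Ψ σ z‖ ^ 2) 0 t := by
      intro t ht
      refine ((hΨ.deriv t z hzc).norm_sq).congr_deriv ?_
      have h1 := h.vectorField_tangent hsmooth hX t (hball t ht).le (hΨ.mapsTo t z hzc)
      simp only [Complex.inner, Complex.mul_re, Complex.conj_re, Complex.conj_im]
      linarith
    have hconst : ‖Ψ σ z‖ ^ 2 = ‖Ψ s z‖ ^ 2 :=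
      (convex_ball s ε).is_const_of_fderivWithin_eq_zero (𝕜 := ℝ)
        (fun t ht => (hderiv t ht).differentiableAt.differentiableWithinAt)
        (fun t ht => by
          rw [fderivWithin_of_isOpen Metric.isOpen_ball ht]
          ext
          simpa using (hderiv t ht).deriv) hσ (Metric.mem_ball_self hε)
    rw [show ‖Ψ s z‖ = 1 from hs, one_pow] at hconst
    exact (pow_eq_one_iff_of_nonneg (norm_nonneg _) two_ne_zero).1 hconst
  refine lt_of_le_of_ne (hle s) fun hs => ?_
  rcases isClopen_iff.1 (⟨hclosed, hopen⟩ : IsClopen {s | ‖Ψ s z‖ = 1}) with hemp | huniv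
  · have : s ∈ {s | ‖Ψ s z‖ = 1} := hs
    rw [hemp] at this
    exact this
  · have h0 : (0 : ℝ) ∈ {s | ‖Ψ s z‖ = 1} := by rw [huniv]; trivial
    have h0' : ‖Ψ 0 z‖ = 1 := h0
    rw [hΨ.initial z hzc] at h0'
    exact (mem_openDisc.1 hz).ne h0'

/-- The suspension of the isotopy, as a curve on the sphere. -/
noncomputable def suspensionCurve (Ψ : ℝ → ℂ → ℂ) (k : ℕ) (z : ℂ) (s : ℝ) : CTwo :=
  pairC (Ψ s z * Complex.exp ((k * s : ℝ) * Complex.I))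
    ((Real.sqrt (1 - ‖Ψ s z‖ ^ 2) : ℝ) * Complex.exp (s * Complex.I))

lemma suspensionCurve_mem {k : ℕ} {z : ℂ} {s : ℝ} (h : ‖Ψ s z‖ ≤ 1) :
    suspensionCurve Ψ k z s ∈ sphereThree := by
  rw [mem_sphereThree, suspensionCurve, pairC_zero, pairC_one, norm_mul_exp_ofReal_mul_I,
    norm_mul_exp_ofReal_mul_I, Complex.norm_of_nonneg (Real.sqrt_nonneg _), Real.sq_sqrt]
  · ring
  · nlinarith [norm_nonneg (Ψ s z)]

/-- The factor `1 / 2` appears because the second coordinate of `kernelField` turns with angular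
speed `2`, whereas the suspension turns with speed `1`. The condition `‖Ψ s z‖ < 1` keeps the square
root differentiable. -/
lemma IsCollarSplitting.hasDerivAt_suspensionCurve (h : IsCollarSplitting H F K r)
    (hX : IsHamiltonianVectorField H X) (hΨ : IsIsotopyGeneratedBy X Ψ) {z : ℂ}
    (hz : z ∈ closedDisc) (k : ℕ) {s : ℝ} (hlt : ‖Ψ s z‖ < 1) :
    HasDerivAt (suspensionCurve Ψ k z)
      ((1 / 2 : ℝ) • kernelField (bCoeff F K k) (suspensionCurve Ψ k z s)) s := by
  have hpos : 0 < 1 - ‖Ψ s z‖ ^ 2 := by linarith [norm_sq_lt_one_iff.2 hlt]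
  set c := Real.sqrt (1 - ‖Ψ s z‖ ^ 2) with hc
  have hc0 : 0 < c := Real.sqrt_pos.2 hpos
  have hq1 : suspensionCurve Ψ k z s 1 = c * Complex.exp (s * Complex.I) := by
    simp [suspensionCurve, hc]
  have hq0 : suspensionCurve Ψ k z s 0 = Ψ s z * Complex.exp ((k * s : ℝ) * Complex.I) := by
    simp [suspensionCurve]
  have hn : ‖suspensionCurve Ψ k z s 1‖ = c := by
    rw [hq1, norm_mul_exp_ofReal_mul_I, Complex.norm_of_nonneg hc0.le]
  have hne : suspensionCurve Ψ k z s 1 ≠ 0 := norm_ne_zero_iff.1 (by rw [hn]; exact hc0.ne')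
  rw [h.kernelField_bCoeff k (suspensionCurve_mem hlt.le) hne (by rw [hn, hq1]) hq0
    (hX s _ (hΨ.mapsTo s z hz)), hn, hq1, hq0]
  have hd := hΨ.deriv s z hz
  have hexp : ∀ a : ℝ, HasDerivAt (fun σ : ℝ => Complex.exp ((a * σ : ℝ) * Complex.I))
      (Complex.exp ((a * s : ℝ) * Complex.I) * (a * Complex.I)) s := fun a =>
    ((((hasDerivAt_id s).const_mul a).ofReal_comp.mul_const Complex.I).cexp).congr_deriv (by simp)
  have h1 : HasDerivAt (fun σ => Real.sqrt (1 - ‖Ψ σ z‖ ^ 2))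
      (-((Ψ s z).re * (X s (Ψ s z)).re + (Ψ s z).im * (X s (Ψ s z)).im) / c) s := by
    refine ((hd.norm_sq.const_sub 1).sqrt hpos.ne').congr_deriv ?_
    simp only [Complex.inner, Complex.mul_re, Complex.conj_re, Complex.conj_im, ← hc]
    field_simp
    ring
  have h2 := HasDerivAt.pairC (hd.mul (hexp k)) (h1.ofReal_comp.mul (hexp 1))
  simp only [one_mul] at h2
  refine HasDerivAt.congr_deriv h2 ?_
  have hcc : (c : ℂ) ≠ 0 := Complex.ofReal_ne_zero.2 hc0.ne'
  apply CTwo.ext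
  · simp
    ring
  · simp [← hc]
    field_simp
    ring

end Isotopy

/-! ### Assembly of the main theorem -/

theorem proposition1p3
    (H : ℝ → ℂ → ℝ)
    (hsmooth : ContDiffOn ℝ ∞ (fun p : ℝ × ℂ => H p.1 p.2) (Set.univ ×ˢ closedDisc))
    (hperiodic : ∀ s : ℝ, ∀ z ∈ closedDisc, H (s + 2 * Real.pi) z = H s z)
    (hcollar : IsAutonomousRadialOnCollar H)
    (X : ℝ → ℂ → ℂ) (hX : IsHamiltonianVectorField H X)
    (Ψ : ℝ → ℂ → ℂ) (hΨ : IsIsotopyGeneratedBy X Ψ)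
    (ψ : ℂ → ℂ) (hψ : ∀ z ∈ closedDisc, ψ z = Ψ (2 * Real.pi) z) :
    EmbedsIntoReebFlowOnSphere ψ := by
  obtain ⟨F, K, r, hS⟩ := exists_collarSplitting hsmooth hperiodic hcollar
  obtain ⟨k, hk⟩ := hS.exists_contactDensity_ge
  have hsub := IsCollarSplitting.sphereThree_subset_smoothDomain hS.lt_one
  have hb : ∀ p ∈ sphereThree, ContDiffAt ℝ ∞ (bCoeff F K k) p := fun p hp =>
    hS.bCoeff_contDiffAt k (hsub hp)
  have hD : ∀ p ∈ sphereThree, contactDensity (bCoeff F K k) p ≠ 0 := fun p hp => by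
    linarith [hk p hp]
  obtain ⟨R, φ, L, hL, hR, hφ⟩ := exists_reeb_flow (IsCollarSplitting.isOpen_smoothDomain r) hsub
    (fun p hp => hS.bCoeff_contDiffAt k hp) hD
  refine ⟨bForm (bCoeff F K k), R, φ, pageMap, discReparam, isContactFormOnSphere_bForm hb hD,
    isReebVectorField_bForm hb hD hR, hφ, isDiscGlobalSurfaceOfSection_pageMap hb hL hk hR hφ,
    discReparam_isRadialReparametrization, fun z hz => ?_⟩
  have hzc : z ∈ closedDisc := Metric.ball_subset_closedBall hz
  have hlt := hS.isotopy_norm_lt_one hsmooth hX hΨ hz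
  have hψlt : ‖ψ z‖ < 1 := by rw [hψ z hzc]; exact hlt _
  refine ⟨mem_openDisc.2 hψlt, ?_⟩
  have h0 : pageMap (discReparam z) = suspensionCurve Ψ k z 0 := by
    rw [pageMap_discReparam (mem_closedDisc.1 hzc), suspensionCurve, hΨ.initial z hzc]
    simp
  have h1 : pageMap (discReparam (ψ z)) = suspensionCurve Ψ k z (2 * Real.pi) := by
    -- The twist closes up after one turn since `k` is an integer.
    have he : Complex.exp ((k * (2 * Real.pi) : ℝ) * Complex.I) = 1 := by
      rw [show ((k * (2 * Real.pi) : ℝ) : ℂ) * Complex.I = k * (2 * Real.pi * Complex.I) by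
        push_cast; ring, Complex.exp_nat_mul_two_pi_mul_I]
    have he' : Complex.exp ((2 * Real.pi : ℝ) * Complex.I) = 1 := by
      push_cast
      exact Complex.exp_two_pi_mul_I
    rw [pageMap_discReparam hψlt.le, suspensionCurve, he, he', hψ z hzc, mul_one, mul_one]
  rw [h0, h1]
  refine isFirstReturn_of_suspension hb hL hk hR hφ (fun s => suspensionCurve_mem (hlt s).le)
    (fun s => hS.hasDerivAt_suspensionCurve hX hΨ hzc k (hlt s)) fun s => ?_
  exact ⟨Real.sqrt (1 - ‖Ψ s z‖ ^ 2),
    Real.sqrt_pos.2 (by linarith [norm_sq_lt_one_iff.2 (hlt s)]), by simp [suspensionCurve]⟩
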